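/- A rooted graph is a finite loopless graph, multiple edges allowed, with a distinguished vertex $\rho$ (the root). Each edge has unit resistance and $R_{\rho x}(G)\in[0,\infty]$ denotes the effective resistance between $\rho$ and $x$ ($\infty$ if $\rho$ and $x$ are not connected). For a rooted graph $G$ with $n\ge 1$ non-root vertices put \[ B(G)=\frac1n\sum_{x\in V(G)}R_{\rho x}(G), \] and for real $\alpha$ let \[ b_n(\alpha)=\min\{B(G): |V(G)|=n+1,\ e(G)\le \alpha n/2\},\qquad b(\alpha)=\lim_{n\to\infty}b_n(\alpha). \] A Queen-Bee network is a rooted graph in which every non-root vertex is joined to the root by at least one edge. Theorem. No Queen-Bee network with average degree strictly greater than $2$ is (asymptotically) optimal among rooted graphs. Precisely: (1) For every real $\alpha>2$ the limit $b(\alpha)$ exists and is finite, and there is $\delta=\delta(\alpha)>0$ such that every Queen-Bee network $G$ with any number $n\ge1$ of non-root vertices and $e(G)\le \alpha n/2$ satisfies \[ B(G)\ \ge\ b(\alpha)+\delta . \] (2) For all real $\alpha_1\ge\alpha_0>2$ there are $\delta>0$ and $N$ such that for all $n\ge N$ and all $\alpha\in[\alpha_0,\alpha_1]$, every Queen-Bee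 network $G$ with $n$ non-root vertices and $e(G)\le\alpha n/2$ satisfies \[ B(G)\ \ge\ b_n(\alpha)+\delta . \] -/

import Mathlib

open Filter Topology
open scoped NNReal ENNReal

/-- A loopless multigraph on the vertex set `V`: `mult s(u, v)` is the number of parallel edges
joining `u` and `v`. Every edge is regarded as a resistor of unit resistance. -/
structure ResistorGraph (V : Type*) where
  mult : Sym2 V → ℕ
  loopless : ∀ u : V, mult s(u, u) = 0

namespace ResistorGraph

variable {V : Type*} [Fintype V]

/-- The number of edges, counted with multiplicity. -/
def numEdges [DecidableEq V] (G : ResistorGraph V) : ℕ := ∑ e : Sym2 V, G.mult e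

/-- `P` is a potential of a current flow in which unit current enters the network at `x` and
leaves it at `y`. By Ohm's law each of the `mult s(u, w)` edges from `u` to `w` carries the current
`P u - P w`; the equation is the current law at `u`. (If `x = y`, no net current enters.) -/
def IsUnitPotential [DecidableEq V] (G : ResistorGraph V) (x y : V) (P : V → ℝ) : Prop :=
  ∀ u : V, ∑ w : V, (G.mult s(u, w) : ℝ) * (P u - P w) =
    (if u = x then 1 else 0) - (if u = y then 1 else 0)

/-- The effective resistance between `x` and `y`: the potential difference `P x - P y` of the
unit current flow from `x` to `y`. This difference is the same for all potentials of unit current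
flows, so the infimum merely selects the common value; if there is no such flow, that is, if
`x` and `y` lie in different components, the resistance is `∞`. -/
noncomputable def effRes [DecidableEq V] (G : ResistorGraph V) (x y : V) : ℝ≥0∞ :=
  ⨅ (P : V → ℝ) (_ : G.IsUnitPotential x y P), ENNReal.ofReal (P x - P y)

end ResistorGraph

/-- A rooted (multi)graph with `n` non-root vertices. The root is `none`, the non-root vertices are
`some i` with `i : Fin n`. -/
abbrev RootedGraph (n : ℕ) := ResistorGraph (Option (Fin n))

namespace RootedGraph

/-- The average resistance `B(G)` of the `n` non-root vertices to the root. -/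
noncomputable def avgRes {n : ℕ} (G : RootedGraph n) : ℝ≥0∞ :=
  (∑ x : Option (Fin n), G.effRes none x) / (n : ℝ≥0∞)

/-- `G` has average degree at most `α`, in the convention of the rooted model:
`e(G) ≤ α n / 2`, where `n` is the number of non-root vertices. -/
def AvgDegreeLE {n : ℕ} (G : RootedGraph n) (α : ℝ) : Prop :=
  (G.numEdges : ℝ) ≤ α * n / 2

/-- `G` is a Queen-Bee network: every non-root vertex is joined to the root by at least
one edge. -/
def IsQueenBee {n : ℕ} (G : RootedGraph n) : Prop :=
  ∀ i : Fin n, 1 ≤ G.mult s(none, some i)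

/-- `b_n(α)`, the least value of `B(G)` over all rooted graphs `G` with `n` non-root vertices and
at most `α n / 2` edges. (There are finitely many such graphs, so the infimum is a minimum as soon
as `α ≥ 0`.) -/
noncomputable def minAvgRes (n : ℕ) (α : ℝ) : ℝ≥0∞ :=
  ⨅ (G : RootedGraph n) (_ : G.AvgDegreeLE α), G.avgRes

end RootedGraph

/-!
A Queen-Bee network whose vertices have resistances `r x` to the root is improved as follows. Take
many copies of it, delete one root edge at every copy of a vertex `x`, and join the copies of `x`
to a long cycle instead, which costs as many edges as were saved. If only one vertex is treated, the
rest of the network acts on `x` as a conductance `c = 1 / r x - 1` to the root, and the resistance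
`1 / (c + 1)` of `x` changes to about `1 / √(c² + 4 c)`, which is smaller exactly when `r x < 2 / 3`.

All vertices of a set `X` can be treated at once, with the same cyclic shift of the copies, as long
as the Green function `K` of the network is small on `X` as an operator. The Fourier transform in the
cyclic direction decouples the new network (`cycleCover`, with six copies) into copies of the old one
in which the conductance from `X` to the root is changed by `-1, 0, 0, 2, 2, 3`, and each trace is
estimated by `dotProduct_le_of_perturb`; the result is `totalRes_cycleCover_le`. Since all
vertices are joined to the root, `K` is nonnegative with row sums at most one, so by
`exists_sparse_subset` every set of vertices contains a proportional subset on which `K` is almost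
diagonal, and the Schur test bounds its norm there by about the maximum of `r x = K x x`.

By `IsGreen.trichotomy` a vertex of a Queen-Bee network has `r x ≤ 5 / 8`, or is a leaf at the root,
or lies in a triangle with the root. If a positive fraction of the vertices has `r x ≤ 5 / 8`, the cycle
cover improves the average by a fixed amount. Otherwise nearly all of the network consists of leaves
and triangles, which save at most `2 / 3` of resistance for every edge exceeding the number of
vertices; there the explicit network of `realizes_doubleStar`, mixed with leaves, does better. This gives
a gap to `b(α)`, uniform for `α` in compact subsets of `(2, ∞)` (`exists_gap`).

The limit `b(α)` exists by Fekete's lemma, as gluing networks at the root makes `n b_n(α)` subadditive,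
and `b_n → b` locally uniformly because the `b_n` are monotone and `b` is continuous on `(2, ∞)`.
-/

/-! ### Rooted networks given by multiplicities -/

namespace ResistorGraph

/-- The rooted graph on `Option V` with root `none` in which `some u` is joined to the root by `m u`
edges and to `some w` by `a u w` edges. -/
def ofMult {V : Type*} (m : V → ℕ) (a : V → V → ℕ) (hs : ∀ u w, a u w = a w u)
    (h0 : ∀ u, a u u = 0) : ResistorGraph (Option V) where
  mult := Sym2.lift ⟨fun p q => match p, q with
    | none, none => 0
    | none, some v => m v
    | some v, none => m v
    | some u, some w => a u w, by
      rintro (_ | u) (_ | w) <;> simp [hs]⟩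
  loopless := by rintro (_ | u) <;> simp [h0]

section

variable {V : Type*} {m : V → ℕ} {a : V → V → ℕ} {hs : ∀ u w, a u w = a w u}
  {h0 : ∀ u, a u u = 0}

@[simp] lemma ofMult_none_some (v : V) : (ofMult m a hs h0).mult s(none, some v) = m v := rfl

@[simp] lemma ofMult_some_none (v : V) : (ofMult m a hs h0).mult s(some v, none) = m v := rfl

@[simp] lemma ofMult_some_some (u w : V) : (ofMult m a hs h0).mult s(some u, some w) = a u w := rfl

end

variable {V : Type*} [Fintype V] [DecidableEq V]

lemma two_mul_numEdges (G : ResistorGraph V) :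
    2 * G.numEdges = ∑ u : V, ∑ w : V, G.mult s(u, w) := by
  have h1 : ∑ u : V, ∑ w : V, G.mult s(u, w) = ∑ p : V × V, G.mult (Sym2.mk p.1 p.2) := by
    rw [Fintype.sum_prod_type]
  rw [h1, ← Finset.sum_fiberwise (s := Finset.univ) (g := fun p : V × V => s(p.1, p.2)), numEdges,
    Finset.mul_sum]
  refine Finset.sum_congr rfl fun e _ => ?_
  induction e using Sym2.ind with
  | _ u w =>
    rcases eq_or_ne u w with rfl | huw
    · rw [G.loopless, mul_zero, eq_comm]
      refine Finset.sum_eq_zero fun p hp => ?_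
      rw [(Finset.mem_filter.1 hp).2, G.loopless]
    · have : (Finset.univ.filter fun p : V × V => s(p.1, p.2) = s(u, w)) = {(u, w), (w, u)} := by
        ext ⟨p, q⟩
        simp
      rw [this, Finset.sum_pair (by simp [huw])]
      simp only [Sym2.eq_swap (a := w)]
      ring

lemma two_mul_numEdges_option (G : ResistorGraph (Option V)) :
    2 * G.numEdges = 2 * ∑ u : V, G.mult s(none, some u) +
      ∑ u : V, ∑ w : V, G.mult s(some u, some w) := by
  rw [two_mul_numEdges]
  simp only [Fintype.sum_option, G.loopless, Finset.sum_add_distrib,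
    Sym2.eq_swap (a := some _) (b := none)]
  ring

/-- A solution `v` of the grounded equations for a unit source at `x`, with the root at voltage zero,
bounds the effective resistance. The current law at the root need not be checked: it is the sum of
the equations at the other vertices. -/
lemma effRes_le_of_voltage (G : ResistorGraph (Option V)) (x : V) (v : V → ℝ)
    (hv : ∀ u, (G.mult s(none, some u) : ℝ) * v u +
      ∑ w, (G.mult s(some u, some w) : ℝ) * (v u - v w) = if u = x then 1 else 0) :
    G.effRes none (some x) ≤ ENNReal.ofReal (v x) := by
  have hsum : ∑ u, (G.mult s(none, some u) : ℝ) * v u = 1 := by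
    have h := Finset.sum_congr (rfl : (Finset.univ : Finset V) = _) fun u _ => hv u
    rw [Finset.sum_add_distrib, Finset.sum_ite_eq' Finset.univ x] at h
    have hz : ∑ u, ∑ w, (G.mult s(some u, some w) : ℝ) * (v u - v w) = 0 := by
      have h2 : ∑ u, ∑ w, (G.mult s(some u, some w) : ℝ) * (v u - v w) =
          - ∑ u, ∑ w, (G.mult s(some u, some w) : ℝ) * (v u - v w) := by
        conv_lhs => rw [Finset.sum_comm]
        simp only [← Finset.sum_neg_distrib]
        refine Finset.sum_congr rfl fun u _ => Finset.sum_congr rfl fun w _ => ?_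
        rw [Sym2.eq_swap]; ring
      linarith
    simpa [hz] using h
  let P : Option V → ℝ := fun p => p.elim 0 fun u => - v u
  have hP : G.IsUnitPotential none (some x) P := by
    rintro (_ | u)
    · simp [P, Fintype.sum_option, hsum]
    · have h1 : ∀ w, (G.mult s(some u, some w) : ℝ) * (- v u - - v w) =
        - ((G.mult s(some u, some w) : ℝ) * (v u - v w)) := fun w => by ring
      simp only [P, Fintype.sum_option, Option.elim, Option.some_inj, reduceCtorEq, if_false,
        Sym2.eq_swap (a := some u) (b := none), h1, Finset.sum_neg_distrib, ← hv u]
      ring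
  refine (iInf₂_le P hP).trans (le_of_eq ?_)
  simp [P]

lemma IsUnitPotential.voltage {G : ResistorGraph (Option V)} {x : V} {P : Option V → ℝ}
    (hP : G.IsUnitPotential none (some x) P) (u : V) :
    (G.mult s(none, some u) : ℝ) * (P none - P (some u)) +
      ∑ w, (G.mult s(some u, some w) : ℝ) * (P none - P (some u) - (P none - P (some w))) =
      if u = x then 1 else 0 := by
  have := hP (some u)
  simp only [Fintype.sum_option, Option.some_inj, reduceCtorEq, if_false,
    Sym2.eq_swap (a := some u) (b := none)] at this
  have h2 : ∀ w, (G.mult s(some u, some w) : ℝ) * (P none - P (some u) - (P none - P (some w))) =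
    - ((G.mult s(some u, some w) : ℝ) * (P (some u) - P (some w))) := fun w => by ring
  simp only [h2, Finset.sum_neg_distrib]
  linarith

lemma le_effRes_of_voltage (G : ResistorGraph (Option V)) (x : V) (r : ℝ)
    (h : ∀ v : V → ℝ, (∀ u, (G.mult s(none, some u) : ℝ) * v u +
      ∑ w, (G.mult s(some u, some w) : ℝ) * (v u - v w) = if u = x then 1 else 0) → r ≤ v x) :
    ENNReal.ofReal r ≤ G.effRes none (some x) :=
  le_iInf₂ fun _ hP => ENNReal.ofReal_le_ofReal (h _ hP.voltage)

lemma effRes_self (G : ResistorGraph V) (x : V) : G.effRes x x = 0 := by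
  refine le_antisymm ((iInf₂_le (fun _ => 0) ?_).trans (by simp)) zero_le
  intro u; simp

/-- Total resistance of the vertices of a rooted graph to the root. -/
noncomputable def totalRes (G : ResistorGraph (Option V)) : ℝ≥0∞ :=
  ∑ u : V, G.effRes none (some u)

lemma sum_effRes (G : ResistorGraph (Option V)) :
    ∑ x : Option V, G.effRes none x = G.totalRes := by
  rw [Fintype.sum_option, effRes_self, zero_add, totalRes]

/-- Relabelling the vertices of a rooted graph, keeping the root. -/
def relabel {W : Type*} (e : W ≃ V) (G : ResistorGraph (Option V)) : ResistorGraph (Option W) :=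
  ofMult (fun u => G.mult s(none, some (e u))) (fun u w => G.mult s(some (e u), some (e w)))
    (fun u w => by rw [Sym2.eq_swap]) fun u => G.loopless _

variable {W : Type*} [Fintype W] [DecidableEq W]

lemma numEdges_relabel (e : W ≃ V) (G : ResistorGraph (Option V)) :
    (G.relabel e).numEdges = G.numEdges := by
  have h1 := two_mul_numEdges_option G
  have h2 := two_mul_numEdges_option (G.relabel e)
  simp only [relabel, ofMult_none_some, ofMult_some_some] at h2
  rw [e.sum_comp (fun u => G.mult s(none, some u)),
    e.sum_comp (fun u => ∑ w, G.mult s(some u, some (e w)))] at h2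
  have h3 : ∀ u, ∑ w, G.mult s(some u, some (e w)) = ∑ w, G.mult s(some u, some w) :=
    fun u => e.sum_comp fun w => G.mult s(some u, some w)
  simp only [h3] at h2
  simp only [relabel]
  omega

lemma totalRes_relabel_le (e : W ≃ V) (G : ResistorGraph (Option V)) :
    (G.relabel e).totalRes ≤ G.totalRes := by
  rw [totalRes, totalRes, ← e.sum_comp]
  refine Finset.sum_le_sum fun x _ => le_iInf₂ fun P hP => ?_
  refine (effRes_le_of_voltage _ x (fun u => P none - P (some (e u))) fun u => ?_).trans le_rfl
  have := hP.voltage (e u)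
  rw [← e.sum_comp] at this
  simp only [e.apply_eq_iff_eq] at this
  exact this

/-- Two rooted graphs glued at their roots. -/
def glue (G : ResistorGraph (Option V)) (H : ResistorGraph (Option W)) :
    ResistorGraph (Option (V ⊕ W)) :=
  ofMult (Sum.elim (fun u => G.mult s(none, some u)) fun u => H.mult s(none, some u))
    (Sum.elim (fun u => Sum.elim (fun w => G.mult s(some u, some w)) fun _ => 0)
      fun u => Sum.elim (fun _ => 0) fun w => H.mult s(some u, some w))
    (by rintro (u | u) (w | w) <;> simp [Sym2.eq_swap])
    (by rintro (u | u) <;> simp [loopless])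

lemma numEdges_glue (G : ResistorGraph (Option V)) (H : ResistorGraph (Option W)) :
    (G.glue H).numEdges = G.numEdges + H.numEdges := by
  have h1 := two_mul_numEdges_option G
  have h2 := two_mul_numEdges_option H
  have h3 := two_mul_numEdges_option (G.glue H)
  simp only [glue, ofMult_none_some, ofMult_some_some, Fintype.sum_sum_type, Sum.elim_inl,
    Sum.elim_inr, Finset.sum_const_zero, add_zero, zero_add] at h3
  simp only [glue]
  omega

lemma totalRes_glue_le (G : ResistorGraph (Option V)) (H : ResistorGraph (Option W)) :
    (G.glue H).totalRes ≤ G.totalRes + H.totalRes := by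
  rw [totalRes, Fintype.sum_sum_type]
  refine add_le_add (Finset.sum_le_sum fun x _ => le_iInf₂ fun P hP => ?_)
    (Finset.sum_le_sum fun x _ => le_iInf₂ fun P hP => ?_)
  · refine (effRes_le_of_voltage _ (Sum.inl x)
      (Sum.elim (fun u => P none - P (some u)) fun _ => 0) ?_).trans le_rfl
    rintro (u | u)
    · have := hP.voltage u
      simp only [glue, ofMult_none_some, ofMult_some_some, Fintype.sum_sum_type, Sum.elim_inl,
        Sum.elim_inr, Sum.inl.injEq, Nat.cast_zero, zero_mul,
        Finset.sum_const_zero, add_zero]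
      exact this
    · simp [glue, Fintype.sum_sum_type]
  · refine (effRes_le_of_voltage _ (Sum.inr x)
      (Sum.elim (fun _ => 0) fun u => P none - P (some u)) ?_).trans le_rfl
    rintro (u | u)
    · simp [glue, Fintype.sum_sum_type]
    · have := hP.voltage u
      simp only [glue, ofMult_none_some, ofMult_some_some, Fintype.sum_sum_type, Sum.elim_inl,
        Sum.elim_inr, Sum.inr.injEq, Nat.cast_zero, zero_mul,
        Finset.sum_const_zero, zero_add]
      exact this

end ResistorGraph

/-! ### Grounded Laplacians -/

section GroundedLaplacian

open scoped Matrix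

variable {V : Type*} [Fintype V]

/-- The Laplacian of the network with edge conductances `a`, grounded at every vertex `u` through a
resistor of conductance `κ u`: the current leaving `u` when the voltages are `f`. -/
def groundedLap (κ : V → ℝ) (a : V → V → ℝ) : (V → ℝ) →ₗ[ℝ] (V → ℝ) where
  toFun f u := κ u * f u + ∑ w, a u w * (f u - f w)
  map_add' f g := by
    ext u
    simp only [Pi.add_apply]
    have : ∀ w, a u w * (f u + g u - (f w + g w)) = a u w * (f u - f w) + a u w * (g u - g w) :=
      fun w => by ring
    simp only [this, Finset.sum_add_distrib]
    ring
  map_smul' c f := by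
    ext u
    simp only [Pi.smul_apply, smul_eq_mul, RingHom.id_apply, mul_add, Finset.mul_sum]
    congr 1
    · ring
    · exact Finset.sum_congr rfl fun w _ => by ring

variable {κ : V → ℝ} {a : V → V → ℝ}

lemma groundedLap_apply (f : V → ℝ) (u : V) :
    groundedLap κ a f u = κ u * f u + ∑ w, a u w * (f u - f w) := rfl

lemma dotProduct_groundedLap (ha : ∀ u w, a u w = a w u) (f g : V → ℝ) :
    f ⬝ᵥ groundedLap κ a g =
      ∑ u, κ u * f u * g u + (∑ u, ∑ w, a u w * ((f u - f w) * (g u - g w))) / 2 := by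
  simp only [dotProduct, groundedLap_apply, mul_add, Finset.sum_add_distrib, Finset.mul_sum]
  congr 1
  · exact Finset.sum_congr rfl fun u _ => by ring
  · rw [eq_div_iff two_ne_zero, mul_two]
    nth_rw 2 [Finset.sum_comm]
    simp only [← Finset.sum_add_distrib]
    refine Finset.sum_congr rfl fun u _ => Finset.sum_congr rfl fun w _ => ?_
    rw [ha w u]; ring

lemma dotProduct_groundedLap_comm (ha : ∀ u w, a u w = a w u) (f g : V → ℝ) :
    f ⬝ᵥ groundedLap κ a g = g ⬝ᵥ groundedLap κ a f := by
  simp only [dotProduct_groundedLap ha]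
  congr 1
  · exact Finset.sum_congr rfl fun u _ => by ring
  · congr 1
    exact Finset.sum_congr rfl fun u _ => Finset.sum_congr rfl fun w _ => by ring

/-- The energy is at least the energy dissipated in the grounding resistors and in the edges at a
single vertex `y`. -/
lemma star_energy_le (ha : ∀ u w, a u w = a w u) (hn : ∀ u w, 0 ≤ a u w)
    (f : V → ℝ) (y : V) :
    ∑ w, (κ w * f w ^ 2 + a y w * (f y - f w) ^ 2) ≤ f ⬝ᵥ groundedLap κ a f := by
  classical
  rw [dotProduct_groundedLap ha, Finset.sum_add_distrib]
  refine add_le_add (le_of_eq (Finset.sum_congr rfl fun u _ => by ring)) ?_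
  rw [le_div_iff₀ two_pos]
  have hnn : ∀ u w, 0 ≤ a u w * ((f u - f w) * (f u - f w)) :=
    fun u w => mul_nonneg (hn u w) (mul_self_nonneg _)
  rw [mul_two, ← Finset.add_sum_erase _ (fun u => ∑ w, a u w * ((f u - f w) * (f u - f w)))
    (Finset.mem_univ y)]
  refine add_le_add (le_of_eq (Finset.sum_congr rfl fun u _ => by ring)) ?_
  calc ∑ w, a y w * (f y - f w) ^ 2
      = ∑ w ∈ Finset.univ.erase y, a w y * ((f w - f y) * (f w - f y)) := by
        rw [← Finset.add_sum_erase _ _ (Finset.mem_univ y)]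
        simp only [sub_self, ne_eq, OfNat.ofNat_ne_zero, not_false_eq_true, zero_pow, mul_zero,
          zero_add]
        exact Finset.sum_congr rfl fun w _ => by rw [ha y w]; ring
    _ ≤ _ := Finset.sum_le_sum fun w _ =>
        Finset.single_le_sum (f := fun z => a w z * ((f w - f z) * (f w - f z)))
          (fun z _ => hnn w z) (Finset.mem_univ y)

lemma groundedLap_nonneg (ha : ∀ u w, a u w = a w u) (hn : ∀ u w, 0 ≤ a u w)
    (hκ : ∀ u, 0 ≤ κ u) (f : V → ℝ) : 0 ≤ f ⬝ᵥ groundedLap κ a f := by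
  rw [dotProduct_groundedLap ha]
  refine add_nonneg (Finset.sum_nonneg fun u _ => ?_) (div_nonneg (Finset.sum_nonneg fun u _ =>
    Finset.sum_nonneg fun w _ => mul_nonneg (hn u w) (mul_self_nonneg _)) two_pos.le)
  rw [mul_assoc]
  exact mul_nonneg (hκ u) (mul_self_nonneg _)

lemma norm_sq_le_groundedLap (ha : ∀ u w, a u w = a w u) (hn : ∀ u w, 0 ≤ a u w)
    (hκ : ∀ u, 1 ≤ κ u) (f : V → ℝ) : f ⬝ᵥ f ≤ f ⬝ᵥ groundedLap κ a f := by
  rw [dotProduct_groundedLap ha]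
  refine le_add_of_le_of_nonneg (Finset.sum_le_sum fun u _ => ?_) (div_nonneg (Finset.sum_nonneg
    fun u _ => Finset.sum_nonneg fun w _ => mul_nonneg (hn u w) (mul_self_nonneg _)) two_pos.le)
  nlinarith [hκ u, mul_self_nonneg (f u)]

/-- Maximum principle: if no current is extracted anywhere, all voltages are nonnegative. -/
lemma nonneg_of_groundedLap_nonneg (hn : ∀ u w, 0 ≤ a u w) (hκ : ∀ u, 0 < κ u) {f : V → ℝ}
    (hf : ∀ u, 0 ≤ groundedLap κ a f u) (u : V) : 0 ≤ f u := by
  obtain ⟨x, -, hx⟩ := Finset.exists_min_image Finset.univ f ⟨u, Finset.mem_univ u⟩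
  refine le_trans ?_ (hx u (Finset.mem_univ u))
  by_contra! hneg
  have h1 := hf x
  rw [groundedLap_apply] at h1
  have h2 : ∑ w, a x w * (f x - f w) ≤ 0 := Finset.sum_nonpos fun w _ =>
    mul_nonpos_of_nonneg_of_nonpos (hn x w) (sub_nonpos.2 (hx w (Finset.mem_univ w)))
  nlinarith [mul_neg_of_pos_of_neg (hκ x) hneg]

lemma exists_groundedLap_eq (h : ∀ f : V → ℝ, f ⬝ᵥ groundedLap κ a f ≤ 0 → f = 0) (v : V → ℝ) :
    ∃ f, groundedLap κ a f = v := by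
  have hinj : Function.Injective (groundedLap κ a) := by
    rw [injective_iff_map_eq_zero]
    intro f hf
    exact h f (by rw [hf, dotProduct_zero])
  exact LinearMap.injective_iff_surjective.1 hinj v

variable [DecidableEq V]

lemma groundedLap_add_indicator (X : Finset V) (s : ℝ) (f : V → ℝ) :
    groundedLap (fun u => κ u + if u ∈ X then s else 0) a f =
      groundedLap κ a f + s • fun u => if u ∈ X then f u else 0 := by
  ext u
  simp only [groundedLap_apply, Pi.add_apply, Pi.smul_apply, smul_eq_mul]
  split_ifs <;> ring

lemma dotProduct_indicator (X : Finset V) (f g : V → ℝ) :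
    f ⬝ᵥ (fun u => if u ∈ X then g u else 0) = ∑ u ∈ X, f u * g u := by
  simp [dotProduct, mul_ite, Finset.sum_ite_mem]

/-- Effect on the resistance of adding conductance `s > -1/γ` to the ground at every vertex of `X`,
when the energy controls `γ⁻¹` times the square norm on `X`. -/
lemma dotProduct_le_of_perturb (ha : ∀ u w, a u w = a w u) {X : Finset V} {γ s : ℝ} (hγ : 0 < γ)
    (hs : 0 < 1 + s * γ) (hX : ∀ f : V → ℝ, ∑ x ∈ X, f x ^ 2 ≤ γ * (f ⬝ᵥ groundedLap κ a f))
    {v f u : V → ℝ} (hf : groundedLap κ a f = v)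
    (hu : groundedLap (fun u => κ u + if u ∈ X then s else 0) a u = v) :
    v ⬝ᵥ u ≤ v ⬝ᵥ f - s / (1 + s * γ) * ∑ x ∈ X, f x ^ 2 := by
  rw [groundedLap_add_indicator] at hu
  set P : (V → ℝ) → V → ℝ := fun g u => if u ∈ X then g u else 0 with hP
  have hvu : v ⬝ᵥ u = v ⬝ᵥ f - s * ∑ x ∈ X, f x * u x := by
    have h1 : f ⬝ᵥ groundedLap κ a u + s * ∑ x ∈ X, f x * u x = f ⬝ᵥ v := by
      rw [← hu, dotProduct_add, dotProduct_smul, dotProduct_indicator, smul_eq_mul]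
    rw [dotProduct_groundedLap_comm ha, hf, dotProduct_comm u, dotProduct_comm f] at h1
    linarith
  set w : V → ℝ := f - u with hw
  have hu' : ∀ x, u x = f x - w x := fun x => by simp [hw]
  have hwE : w ⬝ᵥ groundedLap κ a w = s * ∑ x ∈ X, w x * u x := by
    have h1 : groundedLap κ a w = s • P u := by
      rw [hw, map_sub, hf, ← hu]; abel
    rw [h1, dotProduct_smul, dotProduct_indicator, smul_eq_mul]
  have hXw := hX w
  set A := ∑ x ∈ X, f x ^ 2
  set B := ∑ x ∈ X, w x ^ 2
  set C := ∑ x ∈ X, f x * w x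
  have e1 : ∑ x ∈ X, w x * u x = C - B := by
    simp only [C, B, ← Finset.sum_sub_distrib]
    exact Finset.sum_congr rfl fun x _ => by rw [hu']; ring
  have e2 : ∑ x ∈ X, f x * u x = A - C := by
    simp only [A, C, ← Finset.sum_sub_distrib]
    exact Finset.sum_congr rfl fun x _ => by rw [hu']; ring
  have hsq : 0 ≤ s ^ 2 * γ ^ 2 * A - 2 * (s * γ * (1 + s * γ)) * C + (1 + s * γ) ^ 2 * B := by
    have : s ^ 2 * γ ^ 2 * A - 2 * (s * γ * (1 + s * γ)) * C + (1 + s * γ) ^ 2 * B =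
        ∑ x ∈ X, (s * γ * f x - (1 + s * γ) * w x) ^ 2 := by
      simp only [A, B, C, Finset.mul_sum, ← Finset.sum_sub_distrib, ← Finset.sum_add_distrib]
      exact Finset.sum_congr rfl fun x _ => by ring
    rw [this]
    exact Finset.sum_nonneg fun x _ => sq_nonneg _
  rw [hwE, e1] at hXw
  rw [hvu, e2]
  -- `hXw` reads `(1 + s γ) B ≤ s γ C`; with `hsq` this gives `(1 + s γ) (s C) ≤ s² γ A`
  have key : (1 + s * γ) * (s * C) ≤ s ^ 2 * γ * A := by
    have h3 : (1 + s * γ) * ((1 + s * γ) * B) ≤ (1 + s * γ) * (s * γ * C) :=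
      mul_le_mul_of_nonneg_left (by linarith) hs.le
    have h4 : γ * ((1 + s * γ) * (s * C)) ≤ γ * (s ^ 2 * γ * A) := by nlinarith
    exact le_of_mul_le_mul_left h4 hγ
  have h5 : s * C ≤ s ^ 2 * γ * A / (1 + s * γ) := by
    rw [le_div_iff₀ hs]; linarith
  have h6 : s * A - s ^ 2 * γ * A / (1 + s * γ) = s / (1 + s * γ) * A := by
    field_simp; ring
  linarith

end GroundedLaplacian

/-! ### Green functions of Queen-Bee networks -/

section Green

open scoped Matrix

variable {V : Type*} [Fintype V] [DecidableEq V] {κ : V → ℝ} {a : V → V → ℝ}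

/-- `K x` is the voltage when a unit current enters at `x` and leaves through the ground. -/
def IsGreen (κ : V → ℝ) (a : V → V → ℝ) (K : V → V → ℝ) : Prop :=
  ∀ x, groundedLap κ a (K x) = Pi.single x 1

lemma exists_isGreen (h : ∀ f : V → ℝ, f ⬝ᵥ groundedLap κ a f ≤ 0 → f = 0) :
    ∃ K, IsGreen κ a K :=
  Classical.skolem.1 fun x => exists_groundedLap_eq h (Pi.single x 1)

namespace IsGreen

variable {K : V → V → ℝ}

lemma dotProduct_left (hK : IsGreen κ a K) (ha : ∀ u w, a u w = a w u) (x : V) (f : V → ℝ) :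
    K x ⬝ᵥ groundedLap κ a f = f x := by
  rw [dotProduct_groundedLap_comm ha, hK, dotProduct_single, mul_one]

lemma symm (hK : IsGreen κ a K) (ha : ∀ u w, a u w = a w u) (x y : V) : K x y = K y x := by
  rw [← hK.dotProduct_left ha y (K x), dotProduct_groundedLap_comm ha, hK.dotProduct_left ha]

lemma nonneg (hK : IsGreen κ a K) (hn : ∀ u w, 0 ≤ a u w) (hκ : ∀ u, 0 < κ u) (x y : V) :
    0 ≤ K x y := by
  refine nonneg_of_groundedLap_nonneg hn hκ (fun u => ?_) y
  rw [hK]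
  by_cases h : u = x <;> simp [h]

/-- At most the whole unit of current reaches the ground, so if every vertex is grounded with
conductance at least one, then the voltages sum to at most one. -/
lemma sum_le_one (hK : IsGreen κ a K) (ha : ∀ u w, a u w = a w u) (hn : ∀ u w, 0 ≤ a u w)
    (hκ : ∀ u, 1 ≤ κ u) (x : V) : ∑ y, K x y ≤ 1 := by
  have h : 0 ≤ (fun u => 1 - ∑ y, K y u) x := by
    refine nonneg_of_groundedLap_nonneg (κ := κ) (a := a) (f := fun u => 1 - ∑ y, K y u) hn
      (fun u => one_pos.trans_le (hκ u)) (fun u => ?_) x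
    have h1 : (fun u => 1 - ∑ y, K y u) = (fun _ => 1) - ∑ y, K y := by
      ext u; simp
    rw [h1, map_sub, map_sum]
    have h2 : ∀ y, groundedLap κ a (K y) = Pi.single y 1 := hK
    simp only [h2, Pi.sub_apply, Finset.sum_apply, Finset.sum_pi_single, Finset.mem_univ, if_true]
    simpa [groundedLap_apply] using hκ u
  simp only [sub_nonneg] at h
  simpa only [hK.symm ha x] using h

/-- Schur test: if the rows of the Green function restricted to `X` sum to at most `γ`, then its
restriction to `X` has norm at most `γ`; dually, the energy controls the norm on `X`. -/
lemma sum_sq_le (hK : IsGreen κ a K) (ha : ∀ u w, a u w = a w u) (hn : ∀ u w, 0 ≤ a u w)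
    (hκ : ∀ u, 1 ≤ κ u) {X : Finset V} {γ : ℝ} (hγ : 0 < γ)
    (hX : ∀ x ∈ X, ∑ y ∈ X, K x y ≤ γ) (f : V → ℝ) :
    ∑ x ∈ X, f x ^ 2 ≤ γ * (f ⬝ᵥ groundedLap κ a f) := by
  set p : V → ℝ := ∑ x ∈ X, f x • K x with hp
  have hLp : groundedLap κ a p = fun u => if u ∈ X then f u else 0 := by
    have h2 : ∀ y, groundedLap κ a (K y) = Pi.single y 1 := hK
    ext u
    simp [hp, map_sum, map_smul, h2, Pi.single_apply]
  have h1 : f ⬝ᵥ groundedLap κ a p = ∑ x ∈ X, f x ^ 2 := by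
    rw [hLp, dotProduct_indicator]
    exact Finset.sum_congr rfl fun x _ => by ring
  have h2 : p ⬝ᵥ groundedLap κ a p ≤ γ * ∑ x ∈ X, f x ^ 2 := by
    have h3 : p ⬝ᵥ groundedLap κ a p = ∑ x ∈ X, ∑ y ∈ X, K x y * (f x * f y) := by
      rw [hLp, dotProduct_indicator, Finset.sum_comm]
      refine Finset.sum_congr rfl fun x _ => ?_
      rw [hp, Finset.sum_apply, Finset.sum_mul]
      exact Finset.sum_congr rfl fun y _ => by simp; ring
    have h4 : ∑ x ∈ X, ∑ y ∈ X, K x y * (f x * f y) ≤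
        ∑ x ∈ X, ∑ y ∈ X, (K x y * f x ^ 2 / 2 + K y x * f y ^ 2 / 2) := by
      refine Finset.sum_le_sum fun x _ => Finset.sum_le_sum fun y _ => ?_
      rw [hK.symm ha y x]
      nlinarith [hK.nonneg hn (fun u => one_pos.trans_le (hκ u)) x y, sq_nonneg (f x - f y),
        mul_nonneg (hK.nonneg hn (fun u => one_pos.trans_le (hκ u)) x y) (sq_nonneg (f x - f y))]
    have h5 : ∑ x ∈ X, ∑ y ∈ X, (K x y * f x ^ 2 / 2 + K y x * f y ^ 2 / 2) =
        ∑ x ∈ X, (∑ y ∈ X, K x y) * f x ^ 2 := by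
      simp only [Finset.sum_add_distrib]
      rw [Finset.sum_comm (f := fun x y => K y x * f y ^ 2 / 2), ← Finset.sum_add_distrib]
      refine Finset.sum_congr rfl fun x _ => ?_
      rw [← Finset.sum_add_distrib, Finset.sum_mul]
      exact Finset.sum_congr rfl fun y _ => by ring
    rw [h3]
    refine h4.trans (h5.trans_le ?_)
    rw [Finset.mul_sum]
    exact Finset.sum_le_sum fun x hx => mul_le_mul_of_nonneg_right (hX x hx) (sq_nonneg _)
  have h6 := groundedLap_nonneg ha hn (fun u => zero_le_one.trans (hκ u)) (γ • f - p)
  simp only [map_sub, map_smul, sub_dotProduct, dotProduct_sub, smul_dotProduct, dotProduct_smul,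
    smul_eq_mul, dotProduct_groundedLap_comm ha p f, h1] at h6
  have h7 : γ * ∑ x ∈ X, f x ^ 2 ≤ γ * (γ * (f ⬝ᵥ groundedLap κ a f)) := by linarith
  exact le_of_mul_le_mul_left h7 hγ

/-- Dirichlet's principle: a lower bound for the resistance from any trial voltage. -/
lemma le_self (hK : IsGreen κ a K) (ha : ∀ u w, a u w = a w u) (hn : ∀ u w, 0 ≤ a u w)
    (hκ : ∀ u, 0 ≤ κ u) (x : V) (f : V → ℝ) :
    2 * f x - f ⬝ᵥ groundedLap κ a f ≤ K x x := by
  have h := groundedLap_nonneg ha hn hκ (f - K x)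
  simp only [map_sub, sub_dotProduct, dotProduct_sub, hK.dotProduct_left ha] at h
  rw [dotProduct_groundedLap_comm ha f (K x), hK.dotProduct_left ha] at h
  linarith

lemma one_div_le_self (hK : IsGreen κ a K) (ha : ∀ u w, a u w = a w u) (h0 : ∀ u, a u u = 0)
    (hn : ∀ u w, 0 ≤ a u w) (hκ : ∀ u, 1 ≤ κ u) (x : V) : 1 / (κ x + ∑ w, a x w) ≤ K x x := by
  set D := κ x + ∑ w, a x w with hD
  have hDpos : 0 < D := add_pos_of_pos_of_nonneg (one_pos.trans_le (hκ x))
    (Finset.sum_nonneg fun w _ => hn x w)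
  have h := hK.le_self ha hn (fun u => zero_le_one.trans (hκ u)) x (Pi.single x (1 / D))
  have h2 : groundedLap κ a (Pi.single x (1 / D)) x = 1 := by
    rw [groundedLap_apply]
    have : ∀ w, a x w * ((Pi.single x (1 / D) : V → ℝ) x - (Pi.single x (1 / D) : V → ℝ) w) =
        a x w * (1 / D) := by
      intro w
      rcases eq_or_ne w x with rfl | hw
      · simp [h0]
      · simp [hw]
    simp only [this, ← Finset.sum_mul]
    rw [Pi.single_eq_same, ← add_mul, ← hD, mul_one_div_cancel hDpos.ne']
  rw [single_dotProduct, h2, Pi.single_eq_same] at h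
  linarith

/-- If the energy controls `c` times the square of the voltage at `x`, then the
resistance at `x` is at most `1 / c`. -/
lemma self_le (hK : IsGreen κ a K) (ha : ∀ u w, a u w = a w u) {x : V} {c : ℝ} (hc : 0 < c)
    (h : c * K x x ^ 2 ≤ K x ⬝ᵥ groundedLap κ a (K x)) : K x x ≤ 1 / c := by
  rw [hK.dotProduct_left ha] at h
  rw [le_div_iff₀ hc]
  by_contra! h1
  have : 0 < K x x := by
    by_contra! h2
    nlinarith
  nlinarith

end IsGreen

/-- In a Queen-Bee network a vertex either has resistance at most `5/8`, or is a leaf at the root,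
or forms a triangle with the root and one other vertex. -/
lemma IsGreen.trichotomy {m : V → ℕ} {a : V → V → ℕ} {K : V → V → ℝ}
    (hK : IsGreen (fun u => (m u : ℝ)) (fun u w => (a u w : ℝ)) K)
    (hs : ∀ u w, a u w = a w u) (h0 : ∀ u, a u u = 0) (hm : ∀ u, 1 ≤ m u) (x : V) :
    K x x ≤ 5 / 8 ∨ (∑ w, a x w = 0 ∧ 1 ≤ K x x) ∨ (∑ w, a x w = 1 ∧ 2 / 3 ≤ K x x) := by
  have ha' : ∀ u w, (a u w : ℝ) = a w u := fun u w => by rw [hs]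
  have hn' : ∀ u w, (0 : ℝ) ≤ a u w := fun u w => Nat.cast_nonneg _
  have hm' : ∀ u, (1 : ℝ) ≤ m u := fun u => by exact_mod_cast hm u
  set f := K x with hf
  -- three resistors to the ground and the two edges between them suffice in every case
  have hE : ∀ (S : Finset V) (y : V), ∑ w ∈ S, ((m w : ℝ) * f w ^ 2 + a y w * (f y - f w) ^ 2) ≤
      f ⬝ᵥ groundedLap (fun u => (m u : ℝ)) (fun u w => (a u w : ℝ)) f := fun S y =>
    (Finset.sum_le_sum_of_subset_of_nonneg (Finset.subset_univ S) fun w _ _ =>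
      add_nonneg (mul_nonneg (Nat.cast_nonneg _) (sq_nonneg _))
        (mul_nonneg (hn' _ _) (sq_nonneg _))).trans (star_energy_le ha' hn' f y)
  have done : (8 / 5 : ℝ) * f x ^ 2 ≤
      f ⬝ᵥ groundedLap (fun u => (m u : ℝ)) (fun u w => (a u w : ℝ)) f → f x ≤ 5 / 8 := fun h =>
    (hK.self_le ha' (by norm_num) h).trans (by norm_num)
  have lb : ∀ {c n : ℕ} {t : ℝ}, c ≤ n → (c : ℝ) * t ^ 2 ≤ n * t ^ 2 := fun h =>
    mul_le_mul_of_nonneg_right (by exact_mod_cast h) (sq_nonneg _)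
  by_cases hmx : 2 ≤ m x
  · left
    apply done
    refine le_trans ?_ (hE {x} x)
    rw [Finset.sum_singleton]
    have := lb (t := f x) hmx
    push_cast at this
    nlinarith [sq_nonneg (f x)]
  have hmx1 : m x = 1 := by have := hm x; omega
  by_cases hdeg : ∀ w, a x w = 0
  · right; left
    refine ⟨Finset.sum_eq_zero fun w _ => hdeg w, ?_⟩
    have := hK.one_div_le_self ha' (fun u => by simp [h0]) hn' hm' x
    simpa [hmx1, hdeg] using this
  push Not at hdeg
  obtain ⟨y, hy⟩ := hdeg
  have hxy : x ≠ y := by rintro rfl; exact hy (h0 x)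
  by_cases hy2 : 2 ≤ a x y
  · left
    apply done
    refine le_trans ?_ (hE {x, y} x)
    rw [Finset.sum_pair hxy]
    have h1 := lb (t := f x) (hm x)
    have h2 := lb (t := f y) (hm y)
    have h3 := lb (t := f x - f y) hy2
    push_cast at h1 h2 h3
    simp only [sub_self]
    nlinarith [sq_nonneg (2 * f x - 3 * f y), sq_nonneg (f x)]
  by_cases hx2 : ∃ z, z ≠ y ∧ a x z ≠ 0
  · obtain ⟨z, hzy, hz⟩ := hx2
    have hxz : x ≠ z := by rintro rfl; exact hz (h0 x)
    left
    apply done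
    refine le_trans ?_ (hE {x, y, z} x)
    rw [Finset.sum_insert (by simp [hxy, hxz]), Finset.sum_pair hzy.symm]
    have h1 := lb (t := f x) (hm x)
    have h2 := lb (t := f y) (hm y)
    have h3 := lb (t := f z) (hm z)
    have h4 := lb (t := f x - f y) (Nat.one_le_iff_ne_zero.2 hy)
    have h5 := lb (t := f x - f z) (Nat.one_le_iff_ne_zero.2 hz)
    push_cast at h1 h2 h3 h4 h5
    simp only [sub_self]
    nlinarith [sq_nonneg (f x - 2 * f y), sq_nonneg (f x - 2 * f z), sq_nonneg (f x)]
  by_cases hmy : 2 ≤ m y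
  · left
    apply done
    refine le_trans ?_ (hE {x, y} x)
    rw [Finset.sum_pair hxy]
    have h1 := lb (t := f x) (hm x)
    have h2 := lb (t := f y) hmy
    have h3 := lb (t := f x - f y) (Nat.one_le_iff_ne_zero.2 hy)
    push_cast at h1 h2 h3
    simp only [sub_self]
    nlinarith [sq_nonneg (f x - 3 * f y), sq_nonneg (f x)]
  by_cases hy3 : ∃ z, z ≠ x ∧ a y z ≠ 0
  · obtain ⟨z, hzx, hz⟩ := hy3
    have hyz : y ≠ z := by rintro rfl; exact hz (h0 y)
    left
    apply done
    refine le_trans ?_ (hE {y, x, z} y)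
    rw [Finset.sum_insert (by simp [hxy.symm, hyz]), Finset.sum_pair hzx.symm]
    have h1 := lb (t := f x) (hm x)
    have h2 := lb (t := f y) (hm y)
    have h3 := lb (t := f z) (hm z)
    have h4 := lb (t := f y - f x) (Nat.one_le_iff_ne_zero.2 (hs x y ▸ hy))
    have h5 := lb (t := f y - f z) (Nat.one_le_iff_ne_zero.2 hz)
    push_cast at h1 h2 h3 h4 h5
    simp only [sub_self]
    nlinarith [sq_nonneg (2 * f x - 5 * f y), sq_nonneg (f y - 2 * f z), sq_nonneg (f x)]
  · right; right
    push Not at hx2 hy3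
    have hay : a x y = 1 := by omega
    have hmy1 : m y = 1 := by have := hm y; omega
    refine ⟨by rw [Finset.sum_eq_single y (fun w _ hw => hx2 w hw) (by simp), hay], ?_⟩
    have h := hK.le_self ha' hn' (fun u => Nat.cast_nonneg _) x
      (Pi.single x (2 / 3) + Pi.single y (1 / 3))
    rw [add_dotProduct, single_dotProduct, single_dotProduct, groundedLap_apply,
      groundedLap_apply, Finset.sum_eq_single y (fun w _ hw => by simp [hx2 w hw]) (by simp),
      Finset.sum_eq_single x (fun w _ hw => by simp [hy3 w hw]) (by simp)] at h
    simp only [hs y x, hay, hmx1, hmy1, Pi.add_apply, Pi.single_eq_same, ne_eq, hxy, hxy.symm,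
      not_false_eq_true, Pi.single_eq_of_ne, Nat.cast_one] at h
    norm_num at h
    linarith

/-- In a symmetric nonnegative matrix with row sums at most one, any set `N` of indices contains a
subset `X` of proportional size on which the matrix is nearly diagonal. -/
lemma exists_sparse_subset {K : V → V → ℝ} (hsymm : ∀ x y, K x y = K y x)
    (hnn : ∀ x y, 0 ≤ K x y) (hrow : ∀ x, ∑ y, K x y ≤ 1) {ε : ℝ} (hε : 0 ≤ ε) (N : Finset V) :
    ∃ X ⊆ N, (∀ x ∈ X, ∑ y ∈ X, K x y ≤ K x x + ε) ∧ ε * N.card ≤ (1 + ε) * X.card := by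
  -- maximize `2 ε |X|` minus the off-diagonal mass on `X`
  obtain ⟨X, hXN, hX⟩ := Finset.exists_max_image N.powerset
    (fun X => 2 * ε * X.card - ∑ x ∈ X, ∑ y ∈ X, K x y + ∑ x ∈ X, K x x)
    ⟨∅, Finset.empty_mem_powerset N⟩
  rw [Finset.mem_powerset] at hXN
  have step : ∀ (Y : Finset V) (x : V), x ∉ Y → ∑ u ∈ insert x Y, ∑ w ∈ insert x Y, K u w =
      ∑ u ∈ Y, ∑ w ∈ Y, K u w + 2 * ∑ w ∈ Y, K x w + K x x := by
    intro Y x hx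
    simp only [Finset.sum_insert hx, Finset.sum_add_distrib]
    simp only [hsymm _ x]
    ring
  refine ⟨X, hXN, fun x hx => ?_, ?_⟩
  · have h := hX (X.erase x) (Finset.mem_powerset.2 ((Finset.erase_subset _ _).trans hXN))
    have hxe : x ∉ X.erase x := Finset.notMem_erase x X
    have h1 := step _ x hxe
    have h2 := Finset.sum_insert (f := fun u => K u u) hxe
    have h3 := Finset.sum_insert (f := fun u => K x u) hxe
    have h4 := Finset.card_insert_of_notMem hxe
    rw [Finset.insert_erase hx] at h1 h2 h3 h4
    simp only [h1, h2, h4] at h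
    push_cast at h
    linarith
  · have h1 : ∀ x ∈ N \ X, ε ≤ ∑ y ∈ X, K x y := by
      intro x hx
      rw [Finset.mem_sdiff] at hx
      have h := hX (insert x X) (Finset.mem_powerset.2 (Finset.insert_subset hx.1 hXN))
      have h2 := step _ x hx.2
      simp only [h2, Finset.sum_insert hx.2 (f := fun u => K u u),
        Finset.card_insert_of_notMem hx.2] at h
      push_cast at h
      linarith
    have h2 : ε * (N \ X).card ≤ X.card := by
      calc ε * (N \ X).card = ∑ x ∈ N \ X, ε := by rw [Finset.sum_const, nsmul_eq_mul, mul_comm]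
        _ ≤ ∑ x ∈ N \ X, ∑ y ∈ X, K x y := Finset.sum_le_sum h1
        _ = ∑ y ∈ X, ∑ x ∈ N \ X, K y x := by
          rw [Finset.sum_comm]
          exact Finset.sum_congr rfl fun _ _ => Finset.sum_congr rfl fun _ _ => hsymm _ _
        _ ≤ ∑ y ∈ X, 1 := Finset.sum_le_sum fun y _ =>
          (Finset.sum_le_sum_of_subset_of_nonneg (Finset.subset_univ _)
            fun z _ _ => hnn y z).trans (hrow y)
        _ = X.card := by simp
    have h3 : ((N \ X).card : ℝ) + X.card = N.card := by
      exact_mod_cast Finset.card_sdiff_add_card_eq_card hXN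
    nlinarith

end Green

/-! ### Replacing root edges by cycles through six copies -/

section CycleCover

open scoped Matrix

variable {V : Type*} [Fintype V] [DecidableEq V]

/-- Six copies of the rooted graph with root multiplicities `m` and edge multiplicities `a`, glued at
the root, in which for every `x ∈ X` one root edge at each copy of `x` is deleted, and the six copies
of `x` are joined to a 6-cycle. -/
def cycleCover (m : V → ℕ) (a : V → V → ℕ) (hs : ∀ u w, a u w = a w u) (h0 : ∀ u, a u u = 0)
    (X : Finset V) : ResistorGraph (Option (V × ZMod 6)) :=
  ResistorGraph.ofMult (fun p => m p.1 - if p.1 ∈ X then 1 else 0)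
    (fun p q => (if p.2 = q.2 then a p.1 q.1 else 0) +
      if p.1 = q.1 then
        if p.1 ∈ X then (if q.2 = p.2 + 1 then 1 else 0) + if q.2 = p.2 - 1 then 1 else 0 else 0
      else 0)
    (by
      rintro ⟨u, i⟩ ⟨w, j⟩
      have h1 : (j = i + 1) = (i = j - 1) := propext (by rw [eq_sub_iff_add_eq, eq_comm])
      have h2 : (j = i - 1) = (i = j + 1) := propext (by rw [eq_sub_iff_add_eq, eq_comm])
      simp only [hs u w, eq_comm (a := i) (b := j), h1, h2]
      rcases eq_or_ne u w with rfl | h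
      · simp only [if_true, add_comm (if i = j - 1 then 1 else 0)]
      · simp [h, h.symm])
    (by
      have h1 : ∀ i : ZMod 6, ¬ (i = i + 1) ∧ ¬ (i = i - 1) := by decide
      rintro ⟨u, i⟩
      simp only [h0, (h1 i).1, (h1 i).2, if_false, ite_self, add_zero])

variable {m : V → ℕ} {a : V → V → ℕ} {hs : ∀ u w, a u w = a w u} {h0 : ∀ u, a u u = 0}
  {X : Finset V}

lemma cycleCover_sum {R : Type*} [CommSemiring R] (w : V) (j : ZMod 6) (F : V × ZMod 6 → R) :
    ∑ q, ((cycleCover m a hs h0 X).mult s(some (w, j), some q) : R) * F q =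
      ∑ y, (a w y : R) * F (y, j) + if w ∈ X then F (w, j + 1) + F (w, j - 1) else 0 := by
  have h1 : ∑ q : V × ZMod 6, (if j = q.2 then (a w q.1 : R) else 0) * F q =
      ∑ y, (a w y : R) * F (y, j) := by
    rw [Fintype.sum_prod_type]
    refine Finset.sum_congr rfl fun y _ => ?_
    rw [Finset.sum_eq_single j (fun l _ hl => by simp [hl.symm]) (by simp)]
    simp
  have h2 : ∑ q : V × ZMod 6, (if w = q.1 then
      if w ∈ X then (if q.2 = j + 1 then (1 : R) else 0) + if q.2 = j - 1 then 1 else 0 else 0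
      else 0) * F q = if w ∈ X then F (w, j + 1) + F (w, j - 1) else 0 := by
    rw [Fintype.sum_prod_type, Finset.sum_eq_single w
      (fun y _ hy => Finset.sum_eq_zero fun l _ => by simp [hy.symm]) (by simp)]
    by_cases hw : w ∈ X
    · simp [hw, add_mul, Finset.sum_add_distrib]
    · simp [hw]
  rw [← h1, ← h2, ← Finset.sum_add_distrib]
  refine Finset.sum_congr rfl fun q _ => ?_
  rw [← add_mul, cycleCover, ResistorGraph.ofMult_some_some]
  push_cast
  rfl

lemma numEdges_cycleCover (hm : ∀ u, 1 ≤ m u) :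
    (cycleCover m a hs h0 X).numEdges = 6 * (ResistorGraph.ofMult m a hs h0).numEdges := by
  have h1 := ResistorGraph.two_mul_numEdges_option (ResistorGraph.ofMult m a hs h0)
  have h2 := ResistorGraph.two_mul_numEdges_option (cycleCover m a hs h0 X)
  have h3 : ∑ p : V × ZMod 6, (cycleCover m a hs h0 X).mult s(none, some p) + 6 * X.card =
      6 * ∑ u, m u := by
    have : ∀ u, m u = (m u - if u ∈ X then 1 else 0) + if u ∈ X then 1 else 0 := fun u => by
      have := hm u
      split_ifs <;> omega
    conv_rhs => rw [Finset.sum_congr rfl fun u _ => this u]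
    rw [Finset.sum_add_distrib, Finset.sum_ite_mem, Finset.univ_inter, ← Finset.card_eq_sum_ones,
      Fintype.sum_prod_type, mul_add, Finset.mul_sum]
    congr 1
    refine Finset.sum_congr rfl fun u _ => ?_
    change ∑ _ : ZMod 6, (m u - if u ∈ X then 1 else 0) = _
    rw [Finset.sum_const, Finset.card_univ, ZMod.card, smul_eq_mul]
  have h4 : ∑ p, ∑ q, (cycleCover m a hs h0 X).mult s(some p, some q) =
      6 * ∑ u, ∑ w, a u w + 12 * X.card := by
    have h5 : ∀ (w : V) (j : ZMod 6),
        ∑ q, (cycleCover m a hs h0 X).mult s(some (w, j), some q) =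
          ∑ y, a w y + if w ∈ X then 2 else 0 := fun w j => by
      have := cycleCover_sum (R := ℕ) (m := m) (a := a) (hs := hs) (h0 := h0) (X := X) w j
        fun _ => 1
      simpa using this
    rw [Fintype.sum_prod_type]
    simp only [h5]
    simp only [Finset.sum_const, Finset.card_univ, ZMod.card, smul_eq_mul, ← Finset.mul_sum,
      Finset.sum_add_distrib, Finset.sum_ite_mem, Finset.univ_inter]
    ring
  simp only [ResistorGraph.ofMult_none_some, ResistorGraph.ofMult_some_some] at h1
  omega

/-- `6` times the kernels of the spectral projections of the cycle of length six, for the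
eigenvalues `0`, `1`, `3` and `4`. -/
def cycleKernel : Fin 4 → ZMod 6 → ℤ :=
  ![![1, 1, 1, 1, 1, 1], ![2, 1, -1, -2, -1, 1], ![2, -1, -1, 2, -1, -1], ![1, -1, 1, -1, 1, -1]]

/-- The eigenvalues of the Laplacian of the cycle of length six, decreased by one: the conductance to
the ground gained at the vertices of `X` in the corresponding Fourier mode. -/
def cycleShift : Fin 4 → ℤ := ![-1, 0, 2, 3]

lemma cycleKernel_eigen : ∀ (k : Fin 4) (d : ZMod 6),
    2 * cycleKernel k d - cycleKernel k (d + 1) - cycleKernel k (d - 1) =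
      (cycleShift k + 1) * cycleKernel k d := by
  decide

lemma sum_cycleKernel : ∀ d : ZMod 6, ∑ k, cycleKernel k d = if d = 0 then 6 else 0 := by
  decide

/-- The voltages on the cycle cover are superpositions of the voltages of the Fourier modes. -/
lemma effRes_cycleCover_le (hm : ∀ u, 1 ≤ m u) (z : V) (i : ZMod 6) (u : Fin 4 → V → ℝ)
    (hu : ∀ k, groundedLap (fun w => (m w : ℝ) + if w ∈ X then (cycleShift k : ℝ) else 0)
      (fun v w => (a v w : ℝ)) (u k) = Pi.single z 1) :
    (cycleCover m a hs h0 X).effRes none (some (z, i)) ≤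
      ENNReal.ofReal ((u 0 z + 2 * u 1 z + 2 * u 2 z + u 3 z) / 6) := by
  set v : V × ZMod 6 → ℝ := fun p => (∑ k, (cycleKernel k (p.2 - i) : ℝ) * u k p.1) / 6 with hv
  have hvz : v (z, i) = (u 0 z + 2 * u 1 z + 2 * u 2 z + u 3 z) / 6 := by
    have h : ∀ k, cycleKernel k 0 = if k = 0 ∨ k = 3 then 1 else 2 := by decide
    simp [hv, Fin.sum_univ_four, h]
  rw [← hvz]
  refine ResistorGraph.effRes_le_of_voltage _ _ v ?_
  rintro ⟨w, j⟩
  rw [cycleCover_sum w j fun q => v (w, j) - v q]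
  have e1 : ∑ y, (a w y : ℝ) * (v (w, j) - v (y, j)) =
      (∑ k, (cycleKernel k (j - i) : ℝ) * ∑ y, (a w y : ℝ) * (u k w - u k y)) / 6 := by
    calc ∑ y, (a w y : ℝ) * (v (w, j) - v (y, j))
        = ∑ y, (∑ k, (cycleKernel k (j - i) : ℝ) * ((a w y : ℝ) * (u k w - u k y))) / 6 := by
          refine Finset.sum_congr rfl fun y _ => ?_
          simp only [hv]
          rw [← sub_div, ← Finset.sum_sub_distrib, ← mul_div_assoc, Finset.mul_sum]
          congr 1
          exact Finset.sum_congr rfl fun k _ => by ring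
      _ = _ := by
          rw [← Finset.sum_div, Finset.sum_comm]
          simp only [Finset.mul_sum]
  have e2 : 2 * v (w, j) - v (w, j + 1) - v (w, j - 1) =
      (∑ k, ((cycleShift k : ℝ) + 1) * (cycleKernel k (j - i) : ℝ) * u k w) / 6 := by
    simp only [hv]
    rw [← mul_div_assoc, ← sub_div, ← sub_div, Finset.mul_sum, ← Finset.sum_sub_distrib,
      ← Finset.sum_sub_distrib]
    congr 1
    refine Finset.sum_congr rfl fun k _ => ?_
    have h := cycleKernel_eigen k (j - i)
    rw [sub_add_eq_add_sub, sub_right_comm j i 1] at h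
    have h' : 2 * (cycleKernel k (j - i) : ℝ) - cycleKernel k (j + 1 - i) -
        cycleKernel k (j - 1 - i) = (cycleShift k + 1) * cycleKernel k (j - i) := by
      exact_mod_cast h
    linear_combination (u k w) * h'
  have e3 : (∑ k, (cycleKernel k (j - i) : ℝ) *
      groundedLap (fun w => (m w : ℝ) + if w ∈ X then (cycleShift k : ℝ) else 0)
        (fun v w => (a v w : ℝ)) (u k) w) / 6 = if (w, j) = (z, i) then 1 else 0 := by
    simp only [hu, ← Finset.sum_mul]
    have h : ∑ k, (cycleKernel k (j - i) : ℝ) = if j = i then 6 else 0 := by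
      have := sum_cycleKernel (j - i)
      simp only [sub_eq_zero] at this
      exact_mod_cast this
    rw [h]
    by_cases h1 : w = z <;> by_cases h2 : j = i <;> simp [h1, h2]
  rw [← e3, e1]
  simp only [groundedLap_apply, mul_add, Finset.sum_add_distrib, add_div]
  rw [← add_assoc, add_right_comm]
  congr 1
  have hmw : ((cycleCover m a hs h0 X).mult s(none, some (w, j)) : ℝ) =
      m w - if w ∈ X then 1 else 0 := by
    rw [cycleCover, ResistorGraph.ofMult_none_some, Nat.cast_sub]
    · simp
    · have := hm w
      split_ifs <;> omega
  rw [hmw]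
  by_cases hw : w ∈ X
  · simp only [hw, if_true]
    have e4 : (∑ k, ((cycleShift k : ℝ) + 1) * (cycleKernel k (j - i) : ℝ) * u k w) / 6 =
        (∑ k, (cycleKernel k (j - i) : ℝ) * ((cycleShift k : ℝ) * u k w)) / 6 + v (w, j) := by
      simp only [hv]
      rw [← add_div, ← Finset.sum_add_distrib]
      congr 1
      exact Finset.sum_congr rfl fun k _ => by ring
    have e5 : (∑ k, (cycleKernel k (j - i) : ℝ) * (((m w : ℝ) + cycleShift k) * u k w)) / 6 =
        (∑ k, (cycleKernel k (j - i) : ℝ) * ((cycleShift k : ℝ) * u k w)) / 6 + m w * v (w, j) := by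
      simp only [hv]
      rw [← mul_div_assoc, ← add_div, Finset.mul_sum, ← Finset.sum_add_distrib]
      congr 1
      exact Finset.sum_congr rfl fun k _ => by ring
    rw [e5]
    linarith
  · simp only [hw, if_false, sub_zero, add_zero, hv]
    rw [← mul_div_assoc, Finset.mul_sum]
    congr 1
    exact Finset.sum_congr rfl fun k _ => by ring

/-- If the Green function restricted to `X` has norm at most `127 / 200`, then the cycle cover has
smaller average resistance than the original network. (An infinite path in place of the cycle would
do so for any norm below `2 / 3`, the resistance in a triangle.) -/
lemma totalRes_cycleCover_le (hm : ∀ u, 1 ≤ m u) {K : V → V → ℝ}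
    (hK : IsGreen (fun u => (m u : ℝ)) (fun u w => (a u w : ℝ)) K)
    (hX : ∀ f : V → ℝ, ∑ x ∈ X, f x ^ 2 ≤ 127 / 200 *
      (f ⬝ᵥ groundedLap (fun u => (m u : ℝ)) (fun u w => (a u w : ℝ)) f)) :
    (cycleCover m a hs h0 X).totalRes ≤
      ENNReal.ofReal (6 * ∑ z, K z z - 1 / 20 * ∑ x ∈ X, K x x ^ 2) := by
  have ha' : ∀ u w, (a u w : ℝ) = a w u := fun u w => by rw [hs]
  have hn' : ∀ u w, (0 : ℝ) ≤ a u w := fun u w => Nat.cast_nonneg _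
  have hm' : ∀ u, (1 : ℝ) ≤ m u := fun u => by exact_mod_cast hm u
  have hsh : ∀ k, (-1 : ℝ) ≤ cycleShift k := fun k => by
    have : ∀ k, -1 ≤ cycleShift k := by decide
    exact_mod_cast this k
  have hform : ∀ (k : Fin 4) (f : V → ℝ), 73 / 200 * (f ⬝ᵥ f) ≤ f ⬝ᵥ groundedLap
      (fun w => (m w : ℝ) + if w ∈ X then (cycleShift k : ℝ) else 0) (fun v w => (a v w : ℝ)) f := by
    intro k f
    rw [groundedLap_add_indicator, dotProduct_add, dotProduct_smul, dotProduct_indicator,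
      smul_eq_mul]
    have h1 := hX f
    have h2 := norm_sq_le_groundedLap ha' hn' hm' f
    have h3 : ∑ x ∈ X, f x * f x = ∑ x ∈ X, f x ^ 2 :=
      Finset.sum_congr rfl fun x _ => (sq _).symm
    have h4 : 0 ≤ ∑ x ∈ X, f x ^ 2 := Finset.sum_nonneg fun x _ => sq_nonneg _
    rw [h3]
    nlinarith [hsh k]
  have hff : ∀ f : V → ℝ, 0 ≤ f ⬝ᵥ f := fun f => Finset.sum_nonneg fun x _ => mul_self_nonneg _
  have hex : ∀ (z : V) (k : Fin 4), ∃ u : V → ℝ, groundedLap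
      (fun w => (m w : ℝ) + if w ∈ X then (cycleShift k : ℝ) else 0) (fun v w => (a v w : ℝ)) u =
      Pi.single z 1 := fun z k => exists_groundedLap_eq (fun f hf => by
        have := hform k f
        exact dotProduct_self_eq_zero.1 (le_antisymm (by linarith) (hff f))) _
  choose u hu using hex
  have hupos : ∀ z k, 0 ≤ u z k z := by
    intro z k
    have h := hform k (u z k)
    rw [hu, dotProduct_single, mul_one] at h
    linarith [hff (u z k)]
  have hule : ∀ z k, u z k z ≤ K z z -
      (cycleShift k : ℝ) / (1 + cycleShift k * (127 / 200)) * ∑ x ∈ X, K z x ^ 2 := by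
    intro z k
    have h := dotProduct_le_of_perturb ha' (X := X) (γ := 127 / 200) (s := cycleShift k)
      (by norm_num) (by nlinarith [hsh k]) hX (hK z) (hu z k)
    simpa using h
  have hgain : ∀ z, (u z 0 z + 2 * u z 1 z + 2 * u z 2 z + u z 3 z) / 6 ≤
      K z z - 1 / 120 * ∑ x ∈ X, K z x ^ 2 := by
    intro z
    have hY : 0 ≤ ∑ x ∈ X, K z x ^ 2 := Finset.sum_nonneg fun x _ => sq_nonneg _
    have h0 := hule z 0
    have h1 := hule z 1
    have h2 := hule z 2
    have h3 := hule z 3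
    have hc : cycleShift 0 = -1 ∧ cycleShift 1 = 0 ∧ cycleShift 2 = 2 ∧ cycleShift 3 = 3 := by
      decide
    rw [hc.1] at h0
    rw [hc.2.1] at h1
    rw [hc.2.2.1] at h2
    rw [hc.2.2.2] at h3
    -- `-1 / (1 - γ) + 4 / (1 + 2 γ) + 3 / (1 + 3 γ) > 1 / 20` for `γ = 127 / 200`
    norm_num at h0 h1 h2 h3
    linarith
  calc (cycleCover m a hs h0 X).totalRes
      ≤ ∑ p : V × ZMod 6, ENNReal.ofReal
          ((u p.1 0 p.1 + 2 * u p.1 1 p.1 + 2 * u p.1 2 p.1 + u p.1 3 p.1) / 6) :=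
        Finset.sum_le_sum fun p _ => effRes_cycleCover_le hm p.1 p.2 (u p.1) (hu p.1)
    _ = ENNReal.ofReal (∑ p : V × ZMod 6,
          (u p.1 0 p.1 + 2 * u p.1 1 p.1 + 2 * u p.1 2 p.1 + u p.1 3 p.1) / 6) := by
        rw [ENNReal.ofReal_sum_of_nonneg]
        intro p _
        have := hupos p.1
        linarith [this 0, this 1, this 2, this 3]
    _ ≤ _ := by
        refine ENNReal.ofReal_le_ofReal ?_
        rw [Fintype.sum_prod_type]
        simp only [Finset.sum_const, Finset.card_univ, ZMod.card, nsmul_eq_mul, ← Finset.mul_sum]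
        have h1 := Finset.sum_le_sum fun z (_ : z ∈ (Finset.univ : Finset V)) => hgain z
        rw [Finset.sum_sub_distrib, ← Finset.mul_sum] at h1
        have h2 : ∑ x ∈ X, K x x ^ 2 ≤ ∑ z, ∑ x ∈ X, K z x ^ 2 :=
          (Finset.sum_le_sum fun x hx => Finset.single_le_sum
            (f := fun y => K x y ^ 2) (fun y _ => sq_nonneg _) hx).trans
          (Finset.sum_le_sum_of_subset_of_nonneg (Finset.subset_univ X)
            fun z _ _ => Finset.sum_nonneg fun x _ => sq_nonneg _)
        push_cast
        linarith

end CycleCover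

/-! ### Optimal networks and the limit `b(α)` -/

section Realizes

/-- Some rooted graph with `n` non-root vertices and at most `e` edges has total resistance at
most `T`. -/
def Realizes (n e : ℕ) (T : ℝ) : Prop :=
  0 ≤ T ∧ ∃ G : RootedGraph n, G.numEdges ≤ e ∧ G.totalRes ≤ ENNReal.ofReal T

lemma realizes_of_graph {V : Type*} [Fintype V] [DecidableEq V] (G : ResistorGraph (Option V))
    {n e : ℕ} {T : ℝ} (hn : Fintype.card V = n) (he : G.numEdges ≤ e) (h0 : 0 ≤ T)
    (hT : G.totalRes ≤ ENNReal.ofReal T) : Realizes n e T := by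
  let f : Fin n ≃ V := (Fintype.equivFinOfCardEq hn).symm
  exact ⟨h0, G.relabel f, (G.numEdges_relabel f).trans_le he, (G.totalRes_relabel_le f).trans hT⟩

namespace Realizes

variable {n e n' e' : ℕ} {T T' : ℝ}

lemma add (h : Realizes n e T) (h' : Realizes n' e' T') :
    Realizes (n + n') (e + e') (T + T') := by
  obtain ⟨h0, G, hG, hT⟩ := h
  obtain ⟨h0', G', hG', hT'⟩ := h'
  refine realizes_of_graph (G.glue G') (by simp) ?_ (add_nonneg h0 h0') ?_
  · rw [ResistorGraph.numEdges_glue]; exact add_le_add hG hG'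
  · rw [ENNReal.ofReal_add h0 h0']
    exact (ResistorGraph.totalRes_glue_le G G').trans (add_le_add hT hT')

lemma star (n : ℕ) : Realizes n n n := by
  refine realizes_of_graph (V := Fin n) (ResistorGraph.ofMult (fun _ => 1) (fun _ _ => 0)
    (fun _ _ => rfl) fun _ => rfl) (by simp) ?_ (Nat.cast_nonneg n) ?_
  · have h := ResistorGraph.two_mul_numEdges_option (V := Fin n) (ResistorGraph.ofMult (fun _ => 1)
      (fun _ _ => 0) (fun _ _ => rfl) fun _ => rfl)
    simp only [ResistorGraph.ofMult_none_some, ResistorGraph.ofMult_some_some,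
      Finset.sum_const_zero, add_zero] at h
    simp at h
    exact h.le
  · calc _ ≤ ∑ _ : Fin n, ENNReal.ofReal 1 := Finset.sum_le_sum fun x _ => by
          refine (ResistorGraph.effRes_le_of_voltage _ x (Pi.single x 1) fun u => ?_).trans ?_
          · simp [Pi.single_apply]
          · simp
      _ = _ := by simp

lemma nsmul (h : Realizes n e T) (p : ℕ) : Realizes (p * n) (p * e) (p * T) := by
  induction p with
  | zero => simpa using star 0
  | succ p ih =>
    have := ih.add h
    push_cast
    rwa [← Nat.succ_mul, ← Nat.succ_mul, ← add_one_mul] at this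

/-- Copies of a network together with leaves at the root. -/
lemma mix (h : Realizes n e T) (p q : ℕ) : Realizes (p * n + q) (p * e + q) (p * T + q) :=
  (h.nsmul p).add (star q)

end Realizes

/-- Seven vertices forming a double star with three and two leaves, each leaf joined to the root:
with four edges more than vertices it saves `43 / 16 > 4 * (2 / 3)` of resistance, more per extra edge
than triangles at the root do. -/
lemma realizes_doubleStar : Realizes 7 11 (69 / 16) := by
  let m : Fin 7 → ℕ := ![0, 0, 1, 1, 1, 1, 1]
  let a : Fin 7 → Fin 7 → ℕ := ![![0, 1, 1, 1, 1, 0, 0], ![1, 0, 0, 0, 0, 1, 1],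
    ![1, 0, 0, 0, 0, 0, 0], ![1, 0, 0, 0, 0, 0, 0], ![1, 0, 0, 0, 0, 0, 0],
    ![0, 1, 0, 0, 0, 0, 0], ![0, 1, 0, 0, 0, 0, 0]]
  -- `32` times the Green function
  let K : Fin 7 → Fin 7 → ℤ := ![![16, 8, 8, 8, 8, 4, 4], ![8, 20, 4, 4, 4, 10, 10],
    ![8, 4, 20, 4, 4, 2, 2], ![8, 4, 4, 20, 4, 2, 2], ![8, 4, 4, 4, 20, 2, 2],
    ![4, 10, 2, 2, 2, 21, 5], ![4, 10, 2, 2, 2, 5, 21]]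
  have hs : ∀ u w, a u w = a w u := by decide
  have h0 : ∀ u, a u u = 0 := by decide
  have hK : ∀ x u, (m u : ℤ) * K x u + ∑ w, (a u w : ℤ) * (K x u - K x w) =
      if u = x then 32 else 0 := by decide
  have hpos : ∀ x, 0 ≤ K x x := by decide
  have htr : ∑ x, K x x = 138 := by decide
  have hmsum : ∑ u, m u = 5 := by decide
  have hasum : ∑ u, ∑ w, a u w = 12 := by decide
  refine realizes_of_graph (ResistorGraph.ofMult m a hs h0) (by simp) ?_ (by norm_num) ?_
  · have h := ResistorGraph.two_mul_numEdges_option (ResistorGraph.ofMult m a hs h0)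
    simp only [ResistorGraph.ofMult_none_some, ResistorGraph.ofMult_some_some, hmsum, hasum] at h
    omega
  · calc _ ≤ ∑ x, ENNReal.ofReal ((K x x : ℝ) / 32) := Finset.sum_le_sum fun x _ => by
          refine ResistorGraph.effRes_le_of_voltage _ x (fun u => (K x u : ℝ) / 32) fun u => ?_
          have h : (m u : ℝ) * K x u + ∑ w, (a u w : ℝ) * (K x u - K x w) =
              if u = x then 32 else 0 := by exact_mod_cast hK x u
          simp only [ResistorGraph.ofMult_none_some, ResistorGraph.ofMult_some_some]
          have h2 : ∀ w, (a u w : ℝ) * ((K x u : ℝ) / 32 - K x w / 32) =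
              (a u w : ℝ) * (K x u - K x w) / 32 := fun w => by ring
          simp only [h2]
          rw [← Finset.sum_div, ← mul_div_assoc, ← add_div, h]
          split_ifs <;> norm_num
      _ = ENNReal.ofReal (69 / 16) := by
          rw [← ENNReal.ofReal_sum_of_nonneg fun x _ => div_nonneg (by exact_mod_cast hpos x)
            (by norm_num), ← Finset.sum_div]
          have h : ∑ x, (K x x : ℝ) = 138 := by exact_mod_cast htr
          rw [h]
          norm_num

end Realizes

namespace RootedGraph

lemma avgRes_eq {n : ℕ} (G : RootedGraph n) : G.avgRes = G.totalRes / n := by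
  rw [avgRes, ResistorGraph.sum_effRes]

/-- The real number `b_n(α)`. -/
noncomputable def minAvg (α : ℝ) (n : ℕ) : ℝ := (minAvgRes n α).toReal

lemma minAvg_nonneg (α : ℝ) (n : ℕ) : 0 ≤ minAvg α n := ENNReal.toReal_nonneg

variable {α : ℝ} {n e : ℕ} {T : ℝ}

lemma minAvgRes_le_of_realizes (h : Realizes n e T) (he : (e : ℝ) ≤ α * n / 2) (hn : n ≠ 0) :
    minAvgRes n α ≤ ENNReal.ofReal (T / n) := by
  obtain ⟨h0, G, hG, hT⟩ := h
  have hG' : G.AvgDegreeLE α := (Nat.cast_le.2 hG).trans he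
  refine (iInf₂_le G hG').trans ?_
  rw [avgRes_eq, ENNReal.ofReal_div_of_pos (by positivity), ENNReal.ofReal_natCast]
  exact ENNReal.div_le_div_right hT _

lemma minAvg_mul_le (h : Realizes n e T) (he : (e : ℝ) ≤ α * n / 2) : minAvg α n * n ≤ T := by
  rcases eq_or_ne n 0 with rfl | hn
  · simpa using h.1
  rw [← le_div_iff₀ (by positivity)]
  exact ENNReal.toReal_le_of_le_ofReal (div_nonneg h.1 (Nat.cast_nonneg n))
    (minAvgRes_le_of_realizes h he hn)

lemma minAvgRes_le_one (hα : 2 ≤ α) (hn : n ≠ 0) : minAvgRes n α ≤ 1 := by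
  have h := minAvgRes_le_of_realizes (α := α) (Realizes.star n)
    (by nlinarith [(Nat.cast_nonneg n : (0 : ℝ) ≤ n)]) hn
  rwa [div_self (by positivity), ENNReal.ofReal_one] at h

lemma ofReal_minAvg (hα : 2 ≤ α) (hn : n ≠ 0) : ENNReal.ofReal (minAvg α n) = minAvgRes n α :=
  ENNReal.ofReal_toReal (ne_top_of_le_ne_top ENNReal.one_ne_top (minAvgRes_le_one hα hn))

lemma minAvg_antitone {β : ℝ} (hβ : 2 ≤ β) (h : β ≤ α) (hn : n ≠ 0) : minAvg α n ≤ minAvg β n := by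
  refine ENNReal.toReal_mono (ne_top_of_le_ne_top ENNReal.one_ne_top (minAvgRes_le_one hβ hn)) ?_
  refine le_iInf₂ fun G hG => iInf₂_le G (hG.trans ?_)
  gcongr

lemma exists_realizes (hα : 2 ≤ α) (hn : n ≠ 0) {ε : ℝ} (hε : 0 < ε) :
    ∃ e T, Realizes n e T ∧ (e : ℝ) ≤ α * n / 2 ∧ T ≤ (minAvg α n + ε) * n := by
  have hpos : 0 ≤ minAvg α n + ε := add_nonneg (minAvg_nonneg α n) hε.le
  have hlt : minAvgRes n α < ENNReal.ofReal (minAvg α n + ε) := by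
    rw [← ofReal_minAvg hα hn, ENNReal.ofReal_lt_ofReal_iff_of_nonneg (minAvg_nonneg α n)]
    linarith
  simp only [minAvgRes, iInf_lt_iff] at hlt
  obtain ⟨G, hG, hlt⟩ := hlt
  refine ⟨G.numEdges, (minAvg α n + ε) * n, ⟨by positivity, G, le_rfl, ?_⟩, hG, le_rfl⟩
  rw [avgRes_eq] at hlt
  rw [ENNReal.ofReal_mul hpos, ENNReal.ofReal_natCast]
  exact (ENNReal.div_le_iff (by exact_mod_cast hn) (ENNReal.natCast_ne_top n)).1 hlt.le

/-- `b` is the limit and the infimum of the numbers `b_n(α)`, `n ≥ 1`. -/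
def IsLimAvg (α b : ℝ) : Prop :=
  Tendsto (minAvg α) atTop (𝓝 b) ∧ ∀ n, n ≠ 0 → b ≤ minAvg α n

/-- Gluing at the root makes `n b_n(α)` subadditive, so that Fekete's lemma applies. -/
lemma exists_isLimAvg (hα : 2 ≤ α) : ∃ b, IsLimAvg α b := by
  have hsub : Subadditive fun n => minAvg α n * n := by
    intro n n'
    rcases eq_or_ne n 0 with rfl | hn
    · simp
    rcases eq_or_ne n' 0 with rfl | hn'
    · simp
    refine le_of_forall_pos_le_add fun ε hε => ?_
    have hN : (0 : ℝ) < n + n' := by positivity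
    obtain ⟨e, T, h, he, hT⟩ := exists_realizes hα hn (div_pos hε hN)
    obtain ⟨e', T', h', he', hT'⟩ := exists_realizes hα hn' (div_pos hε hN)
    have := minAvg_mul_le (α := α) (h.add h') (by push_cast; linarith)
    have h2 : ε / (n + n') * n + ε / (n + n') * n' = ε := by field_simp
    simp only
    linarith
  have hbdd : BddBelow (Set.range fun n : ℕ => minAvg α n * n / n) :=
    ⟨0, by rintro _ ⟨n, rfl⟩; exact div_nonneg (mul_nonneg (minAvg_nonneg α n)
      (Nat.cast_nonneg n)) (Nat.cast_nonneg n)⟩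
  refine ⟨hsub.lim, (hsub.tendsto_lim hbdd).congr' ?_, fun n hn => ?_⟩
  · filter_upwards [eventually_ne_atTop 0] with n hn
    field_simp
  · have := hsub.lim_le_div hbdd hn
    simpa [hn] using this

namespace IsLimAvg

variable {b : ℝ}

lemma nonneg (hb : IsLimAvg α b) : 0 ≤ b :=
  ge_of_tendsto' hb.1 (minAvg_nonneg α)

lemma tendsto_minAvgRes (hb : IsLimAvg α b) (hα : 2 ≤ α) :
    Tendsto (fun n => minAvgRes n α) atTop (𝓝 (ENNReal.ofReal b)) := by
  refine ((ENNReal.continuous_ofReal.tendsto b).comp hb.1).congr' ?_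
  filter_upwards [eventually_ne_atTop 0] with n hn
  exact ofReal_minAvg hα hn

/-- Copies of a network on a fraction `ρ` of the vertices, and leaves at the root elsewhere. -/
lemma le_of_mix (hb : IsLimAvg α b) (hα : 2 ≤ α) (h : Realizes n e T) (hn : n ≠ 0) (hT : T ≤ n)
    {ρ : ℝ} (hρ0 : 0 ≤ ρ) (hρ1 : ρ ≤ 1) (he : ρ * ((e : ℝ) - n) ≤ (α / 2 - 1) * n) :
    b ≤ 1 - ρ * (1 - T / n) := by
  have hn' : (0 : ℝ) < n := by positivity
  have hlim : Tendsto (fun N : ℕ => 1 - ρ * (1 - T / n) + (n - T) * (1 / (N : ℝ))) atTop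
      (𝓝 (1 - ρ * (1 - T / n) + (n - T) * 0)) :=
    tendsto_const_nhds.add (tendsto_const_nhds.mul tendsto_one_div_atTop_nhds_zero_nat)
  rw [mul_zero, add_zero] at hlim
  refine ge_of_tendsto hlim ?_
  filter_upwards [eventually_ne_atTop 0] with N hN
  refine (hb.2 N hN).trans ?_
  have hN' : (0 : ℝ) < N := by positivity
  set p := ⌊ρ * N / n⌋₊ with hp
  have hp1 : (p : ℝ) * n ≤ ρ * N := by
    rw [← le_div_iff₀ hn']
    exact Nat.floor_le (by positivity)
  have hp2 : ρ * N / n < p + 1 := Nat.lt_floor_add_one _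
  have hpN : p * n ≤ N := by
    have : (p : ℝ) * n ≤ N := hp1.trans (mul_le_of_le_one_left hN'.le hρ1)
    exact_mod_cast this
  obtain ⟨q, hq⟩ := Nat.exists_eq_add_of_le hpN
  have hq' : (N : ℝ) = p * n + q := by exact_mod_cast hq
  have hmix := h.mix p q
  rw [← hq] at hmix
  have hedge : (p : ℝ) * (e - n) ≤ (α / 2 - 1) * N := by
    have hα' : 0 ≤ α / 2 - 1 := by linarith
    rcases le_total (e : ℝ) n with hen | hen
    · exact (mul_nonpos_of_nonneg_of_nonpos (Nat.cast_nonneg p) (by linarith)).trans (by positivity)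
    · have h1 : (p : ℝ) * n * (e - n) ≤ ρ * N * (e - n) :=
        mul_le_mul_of_nonneg_right hp1 (by linarith)
      have h2 : N * (ρ * ((e : ℝ) - n)) ≤ N * ((α / 2 - 1) * n) :=
        mul_le_mul_of_nonneg_left he hN'.le
      refine le_of_mul_le_mul_left ?_ hn'
      linarith
  have hle := minAvg_mul_le (α := α) hmix (by push_cast; linarith)
  have hfin : minAvg α N * N ≤ (1 - ρ * (1 - T / n) + (n - T) * (1 / (N : ℝ))) * N := by
    have e1 : (1 - ρ * (1 - T / n) + (n - T) * (1 / (N : ℝ))) * N =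
        N - (ρ * N / n - 1) * (n - T) := by field_simp; ring
    rw [e1]
    have : (ρ * N / n - 1) * (n - T) ≤ p * (n - T) :=
      mul_le_mul_of_nonneg_right (by linarith) (by linarith)
    linarith
  exact le_of_mul_le_mul_right hfin hN'

lemma le_one (hb : IsLimAvg α b) (hα : 2 ≤ α) : b ≤ 1 := by
  have := hb.le_of_mix hα (Realizes.star 1) one_ne_zero (by simp) le_rfl zero_le_one
    (by simp; linarith)
  simpa using this

/-- A modulus of continuity of `b` to the left. -/
lemma le_add (hb : IsLimAvg α b) {β c : ℝ} (hc : IsLimAvg β c) (hβ : 2 < β) (h : β ≤ α) :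
    c ≤ b + (α - β) / (β - 2) := by
  have hβ' : 0 < β - 2 := by linarith
  have hα' : 0 < α - 2 := by linarith
  have hnn : 0 ≤ (α - β) / (β - 2) := div_nonneg (by linarith) hβ'.le
  refine le_of_forall_pos_le_add fun ε hε => ?_
  obtain ⟨n, hn, hnb⟩ := ((eventually_ne_atTop 0).and
    (hb.1.eventually (gt_mem_nhds (show b < b + ε / 2 by linarith)))).exists
  obtain ⟨e, T, hr, he, hT⟩ := exists_realizes (by linarith : 2 ≤ α) hn (half_pos hε)
  have hn' : (0 : ℝ) < n := by positivity
  have hTb : T / n ≤ b + ε := by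
    rw [div_le_iff₀ hn']
    exact hT.trans (mul_le_mul_of_nonneg_right (by linarith) hn'.le)
  rcases le_total T n with hTn | hTn
  · set ρ := (β - 2) / (α - 2) with hρ
    have hρ0 : 0 ≤ ρ := div_nonneg hβ'.le hα'.le
    have hρ1 : ρ ≤ 1 := (div_le_one hα').2 (by linarith)
    have hρ2 : ρ * (α - 2) = β - 2 := div_mul_cancel₀ _ hα'.ne'
    have h1 := hc.le_of_mix hβ.le hr hn hTn hρ0 hρ1 (by
      have : ρ * ((e : ℝ) - n) ≤ ρ * (α * n / 2 - n) :=
        mul_le_mul_of_nonneg_left (by linarith) hρ0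
      nlinarith)
    have h2 : 1 - ρ ≤ (α - β) / (β - 2) := by
      have : 1 - ρ = (α - β) / (α - 2) := by rw [hρ]; field_simp; ring
      rw [this]
      exact div_le_div_of_nonneg_left (by linarith) hβ' (by linarith)
    have h3 : ρ * (T / n) ≤ T / n :=
      mul_le_of_le_one_left (div_nonneg hr.1 hn'.le) hρ1
    linarith
  · have h1 : 1 ≤ T / n := (one_le_div hn').2 hTn
    linarith [hc.le_one hβ.le]

end IsLimAvg

/-- On compact subintervals of `(2, ∞)` the convergence to `b(α)` is uniform: it is so on a finite
grid, and between the points of the grid both sides are controlled by monotonicity and continuity. -/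
lemma eventually_minAvg_le {b : ℝ → ℝ} (hb : ∀ α, 2 ≤ α → IsLimAvg α (b α)) {α₀ : ℝ} (α₁ : ℝ)
    (h0 : 2 < α₀) {δ : ℝ} (hδ : 0 < δ) :
    ∀ᶠ n in atTop, ∀ α, α₀ ≤ α → α ≤ α₁ → minAvg α n ≤ b α + δ := by
  have h0' : 0 < α₀ - 2 := by linarith
  set h := δ / 2 * (α₀ - 2) with hh
  have hpos : 0 < h := by positivity
  set k := ⌊(α₁ - α₀) / h⌋₊ with hk
  have hgrid : ∀ i : ℕ, 2 < α₀ + i * h := fun i => by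
    have : 0 ≤ i * h := by positivity
    linarith
  have hev : ∀ᶠ n in atTop, ∀ i ∈ Finset.range (k + 1),
      minAvg (α₀ + i * h) n < b (α₀ + i * h) + δ / 2 :=
    (Finset.range (k + 1)).eventually_all.2 fun i _ =>
      (hb _ (hgrid i).le).1.eventually (gt_mem_nhds (by linarith))
  filter_upwards [hev, eventually_ne_atTop 0] with n hn hn0 α hα0 hα1
  set i := ⌊(α - α₀) / h⌋₊ with hi
  have hik : i ≤ k := Nat.floor_le_floor (by gcongr)
  have hi1 : i * h ≤ α - α₀ := by
    rw [← le_div_iff₀ hpos]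
    exact Nat.floor_le (div_nonneg (by linarith) hpos.le)
  have hi2 : α - α₀ < (i + 1) * h := by
    rw [← div_lt_iff₀ hpos]
    exact Nat.lt_floor_add_one _
  have h1 := hn i (Finset.mem_range.2 (by omega))
  have h2 := minAvg_antitone (hgrid i).le (by linarith : α₀ + i * h ≤ α) hn0
  have h3 := (hb α (by linarith)).le_add (hb _ (hgrid i).le) (hgrid i) (by linarith)
  have h4 : (α - (α₀ + i * h)) / (α₀ + i * h - 2) ≤ δ / 2 := by
    have hden : 0 < α₀ + i * h - 2 := by linarith [hgrid i]
    rw [div_le_iff₀ hden]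
    have : 0 ≤ i * h := by positivity
    nlinarith
  linarith

end RootedGraph

/-! ### Queen-Bee networks are not optimal -/

namespace RootedGraph

lemma ofMult_eq {V : Type*} (G : ResistorGraph (Option V)) :
    ResistorGraph.ofMult (fun u => G.mult s(none, some u)) (fun u w => G.mult s(some u, some w))
      (fun u w => by rw [Sym2.eq_swap]) (fun u => G.loopless _) = G := by
  cases G with
  | mk mult loopless =>
    simp only [ResistorGraph.ofMult, ResistorGraph.mk.injEq]
    funext e
    induction e using Sym2.ind with
    | _ p q =>
      rcases p with _ | u <;> rcases q with _ | w
      · exact (loopless none).symm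
      · rfl
      · exact congrArg mult Sym2.eq_swap
      · rfl

variable {n : ℕ} {m : Fin n → ℕ} {a : Fin n → Fin n → ℕ} {hs : ∀ u w, a u w = a w u}
  {h0 : ∀ u, a u u = 0} {K : Fin n → Fin n → ℝ} {α b : ℝ}

lemma ofReal_sum_green_le
    (hK : IsGreen (fun u => (m u : ℝ)) (fun u w => (a u w : ℝ)) K) (hpos : ∀ x, 0 ≤ K x x) :
    ENNReal.ofReal (∑ x, K x x) ≤ (ResistorGraph.ofMult m a hs h0).totalRes := by
  rw [ENNReal.ofReal_sum_of_nonneg fun x _ => hpos x]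
  refine Finset.sum_le_sum fun x _ => ResistorGraph.le_effRes_of_voltage _ _ _ fun v hv => ?_
  have ha : ∀ u w, (a u w : ℝ) = a w u := fun u w => by rw [hs]
  have hv' : groundedLap (fun u => (m u : ℝ)) (fun u w => (a u w : ℝ)) v = Pi.single x 1 := by
    ext u
    rw [Pi.single_apply]
    exact hv u
  have h := hK.dotProduct_left ha x v
  rw [hv', dotProduct_single, mul_one] at h
  exact h.le

/-- If many vertices of bounded degree have resistance at most `5 / 8`, then the cycle cover over a
sparse subset of these vertices improves on the network. -/
lemma add_le_of_many_low (hn : n ≠ 0) (hb : IsLimAvg α b) (hm : ∀ u, 1 ≤ m u)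
    (he : ((ResistorGraph.ofMult m a hs h0).numEdges : ℝ) ≤ α * n / 2)
    (hK : IsGreen (fun u => (m u : ℝ)) (fun u w => (a u w : ℝ)) K) {Δ η : ℝ} (hΔ : 0 < Δ)
    {N : Finset (Fin n)} (hN : ∀ x ∈ N, K x x ≤ 5 / 8 ∧ (m x : ℝ) + ∑ w, (a x w : ℝ) ≤ Δ)
    (hcard : η * n ≤ N.card) :
    (b + η / (12120 * Δ ^ 2)) * n ≤ ∑ x, K x x := by
  have ha' : ∀ u w, (a u w : ℝ) = a w u := fun u w => by rw [hs]
  have hn' : ∀ u w, (0 : ℝ) ≤ a u w := fun u w => Nat.cast_nonneg _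
  have hm' : ∀ u, (1 : ℝ) ≤ m u := fun u => by exact_mod_cast hm u
  have hKnn := hK.nonneg hn' fun u => one_pos.trans_le (hm' u)
  have hrow := hK.sum_le_one ha' hn' hm'
  obtain ⟨X, hXN, hX, hXcard⟩ := exists_sparse_subset (hK.symm ha') hKnn hrow
    (ε := 1 / 100) (by norm_num) N
  have hKle : ∀ x, K x x ≤ 1 := fun x =>
    (Finset.single_le_sum (f := fun y => K x y) (fun y _ => hKnn x y) (Finset.mem_univ x)).trans
      (hrow x)
  have hform := hK.sum_sq_le ha' hn' hm' (γ := 127 / 200) (by norm_num) fun x hx =>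
    (hX x hx).trans (by linarith [(hN x (hXN hx)).1])
  have hsq : ∑ x ∈ X, K x x ^ 2 ≤ ∑ x, K x x :=
    (Finset.sum_le_sum_of_subset_of_nonneg (Finset.subset_univ X) fun x _ _ => sq_nonneg _).trans
      (Finset.sum_le_sum fun x _ => by nlinarith [hKnn x x, hKle x])
  have hsq0 : 0 ≤ ∑ x, K x x := Finset.sum_nonneg fun x _ => hKnn x x
  have hreal : Realizes (6 * n) (6 * (ResistorGraph.ofMult m a hs h0).numEdges)
      (6 * ∑ z, K z z - 1 / 20 * ∑ x ∈ X, K x x ^ 2) :=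
    realizes_of_graph (cycleCover m a hs h0 X) (by simp [ZMod.card, mul_comm])
      (numEdges_cycleCover hm).le (by linarith) (totalRes_cycleCover_le hm hK hform)
  have h1 := minAvg_mul_le (α := α) hreal (by push_cast; linarith)
  have h2 := hb.2 (6 * n) (by omega)
  have hnpos : (0 : ℝ) < n := by positivity
  have h3 : b * (6 * n) ≤ minAvg α (6 * n) * (6 * n) :=
    mul_le_mul_of_nonneg_right h2 (by positivity)
  have h4 : (1 / Δ ^ 2) * X.card ≤ ∑ x ∈ X, K x x ^ 2 := by
    rw [mul_comm, ← nsmul_eq_mul, ← Finset.sum_const]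
    refine Finset.sum_le_sum fun x hx => ?_
    have h5 := hK.one_div_le_self ha' (fun u => by simp [h0]) hn' hm' x
    have h6 : 0 < (m x : ℝ) + ∑ w, (a x w : ℝ) := add_pos_of_pos_of_nonneg
      (one_pos.trans_le (hm' x)) (Finset.sum_nonneg fun w _ => hn' x w)
    rw [← one_div_pow]
    exact pow_le_pow_left₀ (by positivity)
      ((one_div_le_one_div_of_le h6 (hN x (hXN hx)).2).trans h5) 2
  have h5 : η * n / 101 ≤ X.card := by linarith
  have h6 : η / (12120 * Δ ^ 2) * n * 120 ≤ ∑ x ∈ X, K x x ^ 2 := by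
    refine le_trans (le_of_eq ?_) ((mul_le_mul_of_nonneg_left h5 (by positivity :
      0 ≤ 1 / Δ ^ 2)).trans h4)
    field_simp
    ring
  push_cast at h1
  linarith

/-- If few vertices have resistance at most `5 / 8`, then the network consists mostly of leaves and
triangles at the root. -/
lemma le_sum_green_of_few_low (hm : ∀ u, 1 ≤ m u)
    (he : ((ResistorGraph.ofMult m a hs h0).numEdges : ℝ) ≤ α * n / 2)
    (hK : IsGreen (fun u => (m u : ℝ)) (fun u w => (a u w : ℝ)) K) {o : ℝ}
    (ho : ((Finset.univ.filter fun x => K x x ≤ 5 / 8).card : ℝ) ≤ o) :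
    (1 - 2 / 3 * (α / 2 - 1)) * n - o ≤ ∑ x, K x x ∧ 2 / 3 * n - o ≤ ∑ x, K x x := by
  have hn' : ∀ u w, (0 : ℝ) ≤ a u w := fun u w => Nat.cast_nonneg _
  have hm' : ∀ u, (1 : ℝ) ≤ m u := fun u => by exact_mod_cast hm u
  have hKnn := hK.nonneg hn' fun u => one_pos.trans_le (hm' u)
  have hE := ResistorGraph.two_mul_numEdges_option (ResistorGraph.ofMult m a hs h0)
  simp only [ResistorGraph.ofMult_none_some, ResistorGraph.ofMult_some_some] at hE
  have hE' : 2 * ((ResistorGraph.ofMult m a hs h0).numEdges : ℝ) =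
      2 * ∑ u, (m u : ℝ) + ∑ u, ((∑ w, a u w : ℕ) : ℝ) := by exact_mod_cast hE
  have hmn : (n : ℝ) ≤ ∑ u, (m u : ℝ) := by
    calc (n : ℝ) = ∑ _ : Fin n, (1 : ℝ) := by simp
      _ ≤ _ := Finset.sum_le_sum fun u _ => hm' u
  have hpt : ∀ x, 1 - 1 / 3 * ((∑ w, a x w : ℕ) : ℝ) - (if K x x ≤ 5 / 8 then 1 else 0) ≤ K x x ∧
      2 / 3 - (if K x x ≤ 5 / 8 then 1 else 0) ≤ K x x := by
    intro x
    have ht : (0 : ℝ) ≤ ((∑ w, a x w : ℕ) : ℝ) := Nat.cast_nonneg _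
    have hx := hKnn x x
    rcases hK.trichotomy hs h0 hm x with h | ⟨h1, h2⟩ | ⟨h1, h2⟩
    · rw [if_pos h]; constructor <;> linarith
    · rw [h1]; split_ifs <;> constructor <;> push_cast <;> linarith
    · rw [h1]; split_ifs <;> constructor <;> push_cast <;> linarith
  have hsum : ∑ x, (if K x x ≤ 5 / 8 then (1 : ℝ) else 0) ≤ o := by
    rwa [Finset.sum_boole]
  have h1 := Finset.sum_le_sum fun x (_ : x ∈ (Finset.univ : Finset (Fin n))) => (hpt x).1
  have h2 := Finset.sum_le_sum fun x (_ : x ∈ (Finset.univ : Finset (Fin n))) => (hpt x).2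
  simp only [Finset.sum_sub_distrib, ← Finset.mul_sum, Finset.sum_const, Finset.card_univ,
    Fintype.card_fin, nsmul_eq_mul] at h1 h2
  constructor <;> linarith

/-- The saving of double stars mixed with leaves at the root. -/
lemma IsLimAvg.le_doubleStar (hα : 2 ≤ α) (hb : IsLimAvg α b) :
    b ≤ 1 - 43 / 64 * (α / 2 - 1) ∨ b ≤ 69 / 112 := by
  rcases le_total (α / 2 - 1) (4 / 7) with h | h
  · left
    have := hb.le_of_mix hα realizes_doubleStar (by norm_num) (by norm_num)
      (ρ := 7 / 4 * (α / 2 - 1)) (by linarith) (by linarith) (by norm_num; linarith)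
    norm_num at this
    linarith
  · right
    have := hb.le_of_mix hα realizes_doubleStar (by norm_num) (by norm_num)
      (ρ := 1) (by norm_num) le_rfl (by norm_num; linarith)
    norm_num at this
    linarith

/-- The quantitative core: a gap between Queen-Bee networks and `b(α)`, locally uniform in `α`. -/
lemma exists_gap {α₀ : ℝ} (α₁ : ℝ) (hα₀ : 2 < α₀) :
    ∃ δ : ℝ, 0 < δ ∧ ∀ (α b : ℝ) (n : ℕ) (G : RootedGraph n), α₀ ≤ α → α ≤ α₁ → IsLimAvg α b →
      n ≠ 0 → G.IsQueenBee → G.AvgDegreeLE α → ENNReal.ofReal (b + δ) ≤ G.avgRes := by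
  set g : ℝ := min ((α₀ / 2 - 1) / 192) (17 / 336) with hg
  have hgpos : 0 < g := lt_min (by linarith) (by norm_num)
  set β : ℝ := max α₀ α₁ with hβ
  have hβpos : 0 < β := lt_of_lt_of_le (by linarith) (le_max_left _ _)
  set η : ℝ := g / 4 with hη
  have hηpos : 0 < η := by positivity
  set Δ : ℝ := β / η with hΔ
  have hΔpos : 0 < Δ := by positivity
  refine ⟨min (g / 2) (η / (12120 * Δ ^ 2)), lt_min (by positivity) (by positivity), ?_⟩
  intro α b n G h0 h1 hb hn hQ he
  have hα : 2 ≤ α := by linarith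
  have hnpos : (0 : ℝ) < n := by positivity
  set δ := min (g / 2) (η / (12120 * Δ ^ 2)) with hδ
  have hδpos : 0 < δ := lt_min (by positivity) (by positivity)
  obtain ⟨m, a, hs, hz, rfl⟩ : ∃ (m : Fin n → ℕ) (a : Fin n → Fin n → ℕ)
      (hs : ∀ u w, a u w = a w u) (hz : ∀ u, a u u = 0), ResistorGraph.ofMult m a hs hz = G :=
    ⟨_, _, _, _, ofMult_eq G⟩
  have hm : ∀ u, 1 ≤ m u := hQ
  have ha' : ∀ u w, (a u w : ℝ) = a w u := fun u w => by rw [hs]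
  have hn' : ∀ u w, (0 : ℝ) ≤ a u w := fun u w => Nat.cast_nonneg _
  have hm' : ∀ u, (1 : ℝ) ≤ m u := fun u => by exact_mod_cast hm u
  obtain ⟨K, hK⟩ := exists_isGreen (κ := fun u => (m u : ℝ)) (a := fun u w => (a u w : ℝ))
    fun f hf => dotProduct_self_eq_zero.1 (le_antisymm
      ((norm_sq_le_groundedLap ha' hn' hm' f).trans hf)
      (Finset.sum_nonneg fun x _ => mul_self_nonneg _))
  have hKnn := hK.nonneg hn' fun u => one_pos.trans_le (hm' u)
  suffices hmain : (b + δ) * n ≤ ∑ x, K x x by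
    rw [avgRes_eq, ENNReal.le_div_iff_mul_le (by simp [hn]) (by simp), ← ENNReal.ofReal_natCast,
      ← ENNReal.ofReal_mul (add_nonneg hb.nonneg hδpos.le)]
    exact (ENNReal.ofReal_le_ofReal hmain).trans (ofReal_sum_green_le hK fun x => hKnn x x)
  set d : Fin n → ℝ := fun x => (m x : ℝ) + ∑ w, (a x w : ℝ) with hd
  set N : Finset (Fin n) := Finset.univ.filter fun x => K x x ≤ 5 / 8 ∧ d x ≤ Δ with hNdef
  rcases le_total (η * n) N.card with hcase | hcase
  · have h2 := add_le_of_many_low hn hb hm he hK hΔpos (η := η) (N := N)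
      (fun x hx => (Finset.mem_filter.1 hx).2) hcase
    refine le_trans ?_ h2
    have : δ ≤ η / (12120 * Δ ^ 2) := min_le_right _ _
    exact mul_le_mul_of_nonneg_right (by linarith) hnpos.le
  · -- by Markov's inequality at most `η n` vertices have degree above `Δ = β / η`
    have hdeg : ((Finset.univ.filter fun x => ¬ d x ≤ Δ).card : ℝ) ≤ η * n := by
      have h2 : Δ * (Finset.univ.filter fun x => ¬ d x ≤ Δ).card ≤ ∑ x, d x := by
        rw [mul_comm, ← nsmul_eq_mul, ← Finset.sum_const]
        refine (Finset.sum_le_sum fun x hx => (not_le.1 (Finset.mem_filter.1 hx).2).le).trans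
          (Finset.sum_le_sum_of_subset_of_nonneg (Finset.subset_univ _) fun x _ _ => ?_)
        exact add_nonneg (Nat.cast_nonneg _) (Finset.sum_nonneg fun w _ => hn' x w)
      have hE := ResistorGraph.two_mul_numEdges_option (ResistorGraph.ofMult m a hs hz)
      simp only [ResistorGraph.ofMult_none_some, ResistorGraph.ofMult_some_some] at hE
      have hE' : 2 * ((ResistorGraph.ofMult m a hs hz).numEdges : ℝ) =
          2 * ∑ u, (m u : ℝ) + ∑ u, ∑ w, (a u w : ℝ) := by exact_mod_cast hE
      have h3 : ∑ x, d x = ∑ u, (m u : ℝ) + ∑ u, ∑ w, (a u w : ℝ) := Finset.sum_add_distrib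
      have h4 : 0 ≤ ∑ u, (m u : ℝ) := Finset.sum_nonneg fun u _ => Nat.cast_nonneg _
      have h5 : ((ResistorGraph.ofMult m a hs hz).numEdges : ℝ) ≤ α * n / 2 := he
      have h6 : α * n ≤ β * n :=
        mul_le_mul_of_nonneg_right (h1.trans (le_max_right _ _)) hnpos.le
      have h7 : Δ * (η * n) = β * n := by rw [hΔ]; field_simp
      exact le_of_mul_le_mul_left (by linarith) hΔpos
    have hfew : ((Finset.univ.filter fun x => K x x ≤ 5 / 8).card : ℝ) ≤ 2 * η * n := by
      have hsub : (Finset.univ.filter fun x => K x x ≤ 5 / 8) ⊆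
          N ∪ Finset.univ.filter fun x => ¬ d x ≤ Δ := by
        intro x hx
        simp only [hNdef, Finset.mem_union, Finset.mem_filter, Finset.mem_univ, true_and] at hx ⊢
        tauto
      have h2 : ((Finset.univ.filter fun x => K x x ≤ 5 / 8).card : ℝ) ≤
          N.card + (Finset.univ.filter fun x => ¬ d x ≤ Δ).card := by
        exact_mod_cast (Finset.card_le_card hsub).trans (Finset.card_union_le _ _)
      linarith
    obtain ⟨hl1, hl2⟩ := le_sum_green_of_few_low hm he hK hfew
    have hδg : δ ≤ g / 2 := min_le_left _ _
    have hg1 : g ≤ (α₀ / 2 - 1) / 192 := min_le_left _ _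
    have hg2 : g ≤ 17 / 336 := min_le_right _ _
    rcases hb.le_doubleStar hα with h2 | h2
    · refine le_trans ?_ hl1
      have h3 : b + δ ≤ 1 - 2 / 3 * (α / 2 - 1) - 2 * η := by
        rw [hη]; linarith
      nlinarith [mul_le_mul_of_nonneg_right h3 hnpos.le]
    · refine le_trans ?_ hl2
      have h3 : b + δ ≤ 2 / 3 - 2 * η := by
        rw [hη]; linarith
      nlinarith [mul_le_mul_of_nonneg_right h3 hnpos.le]

end RootedGraph

theorem theorem9p4 :
    (∀ α : ℝ, 2 < α → ∃ b δ : ℝ≥0, 0 < δ ∧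
      Tendsto (fun n : ℕ => RootedGraph.minAvgRes n α) atTop (𝓝 (b : ℝ≥0∞)) ∧
      ∀ (n : ℕ) (G : RootedGraph n), 1 ≤ n → G.IsQueenBee → G.AvgDegreeLE α →
        (b : ℝ≥0∞) + (δ : ℝ≥0∞) ≤ G.avgRes) ∧
    (∀ α₀ α₁ : ℝ, 2 < α₀ → ∃ δ : ℝ≥0, 0 < δ ∧ ∃ N : ℕ, ∀ (n : ℕ) (α : ℝ) (G : RootedGraph n),
      N ≤ n → α₀ ≤ α → α ≤ α₁ → G.IsQueenBee → G.AvgDegreeLE α →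
        RootedGraph.minAvgRes n α + (δ : ℝ≥0∞) ≤ G.avgRes) := by
  constructor
  · intro α hα
    obtain ⟨b, hb⟩ := RootedGraph.exists_isLimAvg hα.le
    obtain ⟨δ, hδ, h⟩ := RootedGraph.exists_gap α hα
    refine ⟨b.toNNReal, δ.toNNReal, Real.toNNReal_pos.2 hδ, hb.tendsto_minAvgRes hα.le, ?_⟩
    intro n G hn hQ he
    have := h α b n G le_rfl le_rfl hb (by omega) hQ he
    rwa [ENNReal.ofReal_add hb.nonneg hδ.le] at this
  · intro α₀ α₁ hα₀
    obtain ⟨δ, hδ, h⟩ := RootedGraph.exists_gap α₁ hα₀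
    have hlim : ∀ α : ℝ, ∃ b, 2 ≤ α → RootedGraph.IsLimAvg α b := fun α => by
      by_cases hα : 2 ≤ α
      · obtain ⟨b, hb⟩ := RootedGraph.exists_isLimAvg hα
        exact ⟨b, fun _ => hb⟩
      · exact ⟨0, fun h => absurd h hα⟩
    choose b hb using hlim
    obtain ⟨N, hN⟩ := eventually_atTop.1
      (RootedGraph.eventually_minAvg_le hb α₁ hα₀ (half_pos hδ))
    refine ⟨(δ / 2).toNNReal, Real.toNNReal_pos.2 (half_pos hδ), N + 1, ?_⟩
    intro n α G hn h0 h1 hQ he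
    have hα : 2 ≤ α := by linarith
    have hn0 : n ≠ 0 := by omega
    refine le_trans ?_ (h α (b α) n G h0 h1 (hb α hα) hn0 hQ he)
    rw [← RootedGraph.ofReal_minAvg hα hn0]
    change _ + ENNReal.ofReal (δ / 2) ≤ _
    rw [← ENNReal.ofReal_add (RootedGraph.minAvg_nonneg α n) (half_pos hδ).le]
    exact ENNReal.ofReal_le_ofReal (by linarith [hN n (by omega) α h0 h1])
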